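/- **Setting.** Event time is measured by natural numbers and $\delta\ge 1$ is the time granularity. A *stream* is an infinite sequence of tuples and watermarks (natural numbers); each tuple $t$ has a timestamp $t.\tau$. Watermarks do not decrease, and no tuple of the input stream has a timestamp smaller than a watermark that precedes it. An *Aggregate* $A(\Gamma(WA,WS,S_I,f_K,L),f_O)$ keeps, for each epoch $[\ell\,WA,\ell\,WA+WS)$, $\ell\in\mathbb N$, and each value of the key $f_K$, the list $\gamma.\zeta$ of received tuples of that key with timestamp in that epoch (a window instance $\gamma$ with $\gamma.l=\ell\,WA$). When its watermark grows from $W$ to $W'$, it outputs, in any order, the results of all non-empty $\gamma$ with $W<\gamma.l+WS\le W'$. A tuple received at watermark $W$ is added to $\gamma$ iff $W<\gamma.l+WS+L$; if moreover $\gamma.l+WS\le W$ (the tuple is late for $\gamma$), the updated result of $\gamma$ is output at once. The result of $\gamma$ is the tuple with timestamp $\gamma.l+WS-\delta$ and attributes $f_O(\gamma)$; nothing is output if $f_O(\gamma)=\emptyset$. $trig(W)$ is the set of tuples output when the watermark grows to $W$; the successors of a tuple $t$ are the tuples output upon processing $t$ or a successor of $t$. $S_E$ is a stream of tuples $\langle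 \tau, T, -1\rangle$ with $\delta\mid\tau$ and $T$ a finite set, stored as a list without repetitions (indexed from $0$). The *Unfold* operator $X$ emits, upon each tuple $\langle\tau,T,-1\rangle$, the tuple $\langle\tau, o\rangle$ for every $o\in T$. Consider two Aggregates, both with $WA=WS=\delta$ and with all attributes (including $\tau$) as key. $A_1$ has allowed lateness $L$ and input $\{S_E,S_{A_2}\}$, where $S_{A_2}$ is its own output (the watermarks of $S_{A_2}$ are not fed back to it). Its function inspects $t=\gamma.\zeta[0]=\langle\tau,T,i\rangle$: if $i=-1$ it returns $(\bigcup_{t'\in\gamma.\zeta}t'[1],\,0)$; if $i\ne-1$ and $i<|T|$ it returns $(T,i+1)$; otherwise $\emptyset$. $A_2$ has allowed lateness $0$ and input $S_{A_2}$; for $\gamma.\zeta[0]=\langle\tau,T,i\rangle$ it returns $T[i]$ ($\emptyset$ if the index is out of range). The symbol $\bigcup$ may mean either list concatenation (repetitions kept) or set union (repetitions dropped). Both Aggregates are fed $S_{A_2}$ in the same order; $A_1$ uses the watermarks of $S_E$ and forwards them downstream in order. Reception of items of $S_E$, watermark updates of $A_1$, reception of looping tuples, forwarding of watermarks and reception by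 $A_2$ interleave arbitrarily. An update or forwarding may be delayed, but executions are weakly fair: no action stays forever possible without being taken. Here an update to $W$ counts as possible only when C2 below permits it, and the forwarding of $W$ only when no tuple of $trig(W)$ and no successor of such a tuple waits in the loop. **Theorem.** Assume $L\ge D$ and * **C1** for $S_E$: watermarks keep arriving and grow without bound; consecutive watermarks differ by at most $D$; and if $W^0$ is the first watermark, then $W^0-t.\tau\le D$ for every tuple $t$ that precedes it; * **C2** for $A_1$: $A_1$ updates its watermark to $W$ only when every tuple still to be processed in the loop satisfies $W<\gamma.l+\delta+L$ for the window instance $\gamma$ it falls in; * **C3** for $A_1$: $A_1$ feeds $W$ to $A_2$ only after all tuples of $trig(W)$ and all their successors. Then in every fair execution the output $S_O$ of $A_2$ implements $X(S_E)$: 1. $A_1$ never outputs the same tuple twice. 2. A tuple occurs in $S_O$ if and only if it is emitted by $X(S_E)$. 3. If $\bigcup$ keeps repetitions, or if no tuple occurs twice in $S_E$, every tuple occurs in $S_O$ exactly as many times (finitely many) as $X(S_E)$ emits it. -/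

import Mathlib

namespace Streaming

/-! ## Streams, windows and the Aggregate operator

Event time is counted in time units from an epoch, so timestamps, watermarks, window boundaries
and the allowed lateness are natural numbers. -/

/-- A tuple: its timestamp and its remaining attributes. -/
structure Tup (V : Type*) where
  τ : ℕ
  val : V
deriving DecidableEq

/-- What a stream delivers: a tuple or a watermark. -/
inductive Item (β : Type*) where
  | tup (t : β)
  | wm (w : ℕ)
deriving DecidableEq

/-- A window instance handed to an output function: left boundary and content (arrival order). -/
structure WindowInst (V : Type*) where
  l : ℕ
  ζ : List (Tup V)

/-- The parameters of an Aggregate `A(Γ(WA, WS, ·, key, L), fO)`. The output function returns at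
most one value per window instance; `none` stands for `∅`. -/
structure Agg (V K O : Type*) where
  WA : ℕ
  WS : ℕ
  L : ℕ
  key : Tup V → K
  fO : WindowInst V → Option O

/-- The state of a running Aggregate: its watermark (`0` before the first one) and the content of
each window instance, indexed by the number `ℓ` of its epoch and by the key. -/
structure AggState (V K : Type*) where
  wm : ℕ
  win : ℕ → K → List (Tup V)

def AggState.init (V K : Type*) : AggState V K := ⟨0, fun _ _ => []⟩

namespace Agg

variable {V K O : Type*} (A : Agg V K O)

/-- Epoch `ℓ` is `[ℓ WA, ℓ WA + WS)`. -/
def left (ℓ : ℕ) : ℕ := ℓ * A.WA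

def right (ℓ : ℕ) : ℕ := A.left ℓ + A.WS

/-- `t` falls in epoch `ℓ`. -/
def Falls (t : Tup V) (ℓ : ℕ) : Prop := A.left ℓ ≤ t.τ ∧ t.τ < A.right ℓ

/-- At watermark `w` epoch `ℓ` still accepts tuples: with allowed lateness `L` its window instances
are kept until the watermark reaches right boundary plus `L`. -/
def Accepts (w ℓ : ℕ) : Prop := w < A.right ℓ + A.L

/-- Result of a window instance; its timestamp is the right boundary minus `δ`. -/
def result (δ : ℕ) (s : AggState V K) (ℓ : ℕ) (k : K) : Option (Tup O) :=
  (A.fO ⟨A.left ℓ, s.win ℓ k⟩).map fun v => ⟨A.right ℓ - δ, v⟩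

open Classical in
/-- Add `t` to every window instance that it falls in and that still accepts tuples. -/
noncomputable def add (s : AggState V K) (t : Tup V) : AggState V K :=
  { s with win := fun ℓ k =>
      if k = A.key t ∧ A.Falls t ℓ ∧ A.Accepts s.wm ℓ then s.win ℓ k ++ [t] else s.win ℓ k }

end Agg

/-- `l` lists the elements satisfying `p`, each once, in an arbitrary order. -/
def Enumerates {ι : Type*} (l : List ι) (p : ι → Prop) : Prop :=
  l.Nodup ∧ ∀ i, i ∈ l ↔ p i

/-- `A` in state `s` processes tuple `t`, moves to `s'` and outputs `outs`. Results of windows whose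
right boundary the watermark has not reached are left to a later watermark. If `t` is late for an
expired window that still accepts tuples, the (updated) result of that window is output at once. -/
def Agg.OnTuple {V K O : Type*} (A : Agg V K O) (δ : ℕ) (s : AggState V K) (t : Tup V)
    (s' : AggState V K) (outs : List (Tup O)) : Prop :=
  s' = A.add s t ∧
  ∃ ls : List ℕ,
    Enumerates ls (fun ℓ => A.Falls t ℓ ∧ A.Accepts s.wm ℓ ∧ A.right ℓ ≤ s.wm) ∧
    outs = ls.filterMap fun ℓ => A.result δ s' ℓ (A.key t)

/-- `A` in state `s` updates its watermark with `w`, moves to `s'` and outputs `outs`: the results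
of all non-empty window instances whose right boundary is newly reached. -/
def Agg.OnWatermark {V K O : Type*} (A : Agg V K O) (δ : ℕ) (s : AggState V K) (w : ℕ)
    (s' : AggState V K) (outs : List (Tup O)) : Prop :=
  s' = { s with wm := max s.wm w } ∧
  ∃ ws : List (ℕ × K),
    Enumerates ws
      (fun p => s.win p.1 p.2 ≠ [] ∧ s.wm < A.right p.1 ∧ A.right p.1 ≤ s'.wm) ∧
    outs = ws.filterMap fun p => A.result δ s' p.1 p.2

/-! ## Embed outputs and the Unfold operator -/

/-- Attributes (besides the timestamp) of the tuples fed to the first Aggregate: the embedded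
tuples, without timestamp, listed in some order, and an integer. -/
abbrev EVal (α : Type*) := List α × ℤ

abbrev ETup (α : Type*) := Tup (EVal α)

/-- `S` is a stream of Embed outputs: each tuple carries a timestamp on the `δ`-grid, a set of
tuples (a list without repetitions) and the value `-1`. -/
def IsEmbedStream {α : Type*} (δ : ℕ) (S : ℕ → Item (ETup α)) : Prop :=
  ∀ n t, S n = .tup t → δ ∣ t.τ ∧ t.val.1.Nodup ∧ t.val.2 = -1

/-- The meaning of watermarks: they do not decrease, and no tuple is older than a watermark that
precedes it. -/
def WatermarksSound {V : Type*} (S : ℕ → Item (Tup V)) : Prop :=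
  ∀ i j, i < j → ∀ w, S i = .wm w →
    (∀ w', S j = .wm w' → w ≤ w') ∧ (∀ t, S j = .tup t → w ≤ t.τ)

/-- No tuple occurs twice in `S`. -/
def NoRepeats {V : Type*} (S : ℕ → Item (Tup V)) : Prop :=
  ∀ i j t, S i = .tup t → S j = .tup t → i = j

/-- The Unfold operator on a tuple: emit every embedded tuple with the timestamp of the carrier. -/
def unfold {α : Type*} (t : ETup α) : List (Tup α) := t.val.1.map fun o => ⟨t.τ, o⟩

/-- The output of the Unfold operator on the first `m` items of `S`. -/
def unfoldPrefix {α : Type*} (S : ℕ → Item (ETup α)) (m : ℕ) : List (Tup α) :=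
  (List.range m).flatMap fun n =>
    match S n with
    | .tup t => unfold t
    | .wm _ => []

/-- Condition C1 with distance `D`: watermarks keep arriving and progress without bound, consecutive
ones are at most `D` apart, and the first one exceeds the earliest timestamp of the tuples that
precede it (if any) by at most `D`. -/
structure C1 {V : Type*} (S : ℕ → Item (Tup V)) (D : ℕ) : Prop where
  periodic : ∀ b, ∃ n w, b ≤ w ∧ S n = .wm w
  consecutive : ∀ i j w w', i < j → S i = .wm w → S j = .wm w' →
    (∀ k v, i < k → k < j → S k ≠ .wm v) → w' ≤ w + D
  first : ∀ j w, S j = .wm w → (∀ k v, k < j → S k ≠ .wm v) →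
    ∀ i t, i < j → S i = .tup t → w ≤ t.τ + D

/-! ## The two Aggregates -/

/-- The two readings of `T ∪ T'` for collections held as lists: keep repetitions (concatenation) or
drop them (set union). -/
inductive UnionReading where
  | bag
  | set
deriving DecidableEq

def UnionReading.union {α : Type*} [DecidableEq α] (u : UnionReading) (T T' : List α) : List α :=
  match u with
  | .bag => T ++ T'
  | .set => T ∪ T'

/-- Output function of the first Aggregate. -/
def fO₁ {α : Type*} [DecidableEq α] (u : UnionReading) (γ : WindowInst (EVal α)) :
    Option (EVal α) :=
  match γ.ζ with
  | [] => none
  | t :: _ =>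
    if t.val.2 = -1 then
      some (γ.ζ.foldl (fun T t' => u.union T t'.val.1) [], 0)
    else if t.val.2 < (t.val.1.length : ℤ) then
      some (t.val.1, t.val.2 + 1)
    else none

/-- Output function of the second Aggregate: the carried tuple at the given index. An index out of
range yields no output. -/
def fO₂ {α : Type*} (γ : WindowInst (EVal α)) : Option α :=
  match γ.ζ with
  | [] => none
  | t :: _ => if 0 ≤ t.val.2 then t.val.1[t.val.2.toNat]? else none

/-- First Aggregate: tumbling windows of size `δ`, key-by on all attributes, lateness `L`. -/
def A₁ {α : Type*} [DecidableEq α] (u : UnionReading) (δ L : ℕ) :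
    Agg (EVal α) (ETup α) (EVal α) where
  WA := δ
  WS := δ
  L := L
  key := id
  fO := fO₁ u

/-- Second Aggregate: tumbling windows of size `δ`, key-by on all attributes, lateness `0`. -/
def A₂ {α : Type*} (δ : ℕ) : Agg (EVal α) (ETup α) α where
  WA := δ
  WS := δ
  L := 0
  key := id
  fO := fO₂

/-! ## Executions of the composition -/

/-- A state of the composition. The output stream `sA2` of the first Aggregate is kept as a log; it
is read, in the same order, by the first Aggregate itself (the loop, which ignores watermarks) and
by the second one. Each logged tuple is annotated with the watermark `w` such that the tuple is in
`trig(w)` or a successor of a tuple of `trig(w)`; no operator reads this annotation. -/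
structure State (α : Type*) where
  /-- number of items of the input stream received so far -/
  pos : ℕ
  /-- state of the first Aggregate -/
  a1 : AggState (EVal α) (ETup α)
  /-- watermarks received from the input stream, not yet used to update the watermark of the
  first Aggregate -/
  pend : List ℕ
  /-- watermarks used for an update but not yet forwarded downstream -/
  fwd : List ℕ
  /-- output stream of the first Aggregate -/
  sA2 : List (Item (ETup α × ℕ))
  /-- how far the first Aggregate has read `sA2` -/
  rd1 : ℕ
  /-- how far the second Aggregate has read `sA2` -/
  rd2 : ℕ
  /-- state of the second Aggregate -/
  a2 : AggState (EVal α) (ETup α)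
  /-- output stream of the second Aggregate -/
  sO : List (Item (Tup α))

def State.init (α : Type*) : State α where
  pos := 0
  a1 := AggState.init _ _
  pend := []
  fwd := []
  sA2 := []
  rd1 := 0
  rd2 := 0
  a2 := AggState.init _ _
  sO := []

/-- Tuples in a log, without their annotation. -/
def tuplesOf {β : Type*} (l : List (Item (β × ℕ))) : List β :=
  l.filterMap fun x =>
    match x with
    | .tup p => some p.1
    | .wm _ => none

/-- Log entries of the outputs `outs` annotated with `w`. -/
def entries {β : Type*} (outs : List β) (w : ℕ) : List (Item (β × ℕ)) :=
  outs.map fun o => .tup (o, w)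

inductive Act where
  /-- the first Aggregate receives the next item of the input stream -/
  | source
  /-- the first Aggregate updates its watermark with the oldest received one -/
  | update
  /-- the first Aggregate reads the next item of its own output -/
  | loop
  /-- the first Aggregate forwards its oldest unforwarded watermark -/
  | forward
  /-- the second Aggregate receives the next item -/
  | deliver

/-- The steps of the composition on input stream `S`. They may be interleaved arbitrarily. -/
inductive Step {α : Type*} [DecidableEq α] (u : UnionReading) (δ L : ℕ)
    (S : ℕ → Item (ETup α)) : Act → State α → State α → Prop
  | sourceTuple (s : State α) (t : ETup α) (a : AggState (EVal α) (ETup α))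
      (outs : List (ETup α)) (hS : S s.pos = .tup t)
      (hA : (A₁ u δ L).OnTuple δ s.a1 t a outs) :
      Step u δ L S .source s
        { s with pos := s.pos + 1, a1 := a, sA2 := s.sA2 ++ entries outs s.a1.wm }
  | sourceWatermark (s : State α) (w : ℕ) (hS : S s.pos = .wm w) :
      Step u δ L S .source s { s with pos := s.pos + 1, pend := s.pend ++ [w] }
  | update (s : State α) (w : ℕ) (ws : List ℕ) (a : AggState (EVal α) (ETup α))
      (outs : List (ETup α)) (hw : s.pend = w :: ws)
      (hA : (A₁ u δ L).OnWatermark δ s.a1 w a outs) :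
      Step u δ L S .update s
        { s with pend := ws, fwd := s.fwd ++ [w], a1 := a, sA2 := s.sA2 ++ entries outs w }
  | loopTuple (s : State α) (t : ETup α) (w : ℕ) (a : AggState (EVal α) (ETup α))
      (outs : List (ETup α)) (ht : s.sA2[s.rd1]? = some (.tup (t, w)))
      (hA : (A₁ u δ L).OnTuple δ s.a1 t a outs) :
      Step u δ L S .loop s
        { s with rd1 := s.rd1 + 1, a1 := a, sA2 := s.sA2 ++ entries outs w }
  | loopWatermark (s : State α) (w : ℕ) (hw : s.sA2[s.rd1]? = some (.wm w)) :
      Step u δ L S .loop s { s with rd1 := s.rd1 + 1 }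
  | forward (s : State α) (w : ℕ) (ws : List ℕ) (hw : s.fwd = w :: ws) :
      Step u δ L S .forward s { s with fwd := ws, sA2 := s.sA2 ++ [.wm w] }
  | deliverTuple (s : State α) (t : ETup α) (w : ℕ) (a : AggState (EVal α) (ETup α))
      (outs : List (Tup α)) (ht : s.sA2[s.rd2]? = some (.tup (t, w)))
      (hA : (A₂ δ).OnTuple δ s.a2 t a outs) :
      Step u δ L S .deliver s
        { s with rd2 := s.rd2 + 1, a2 := a, sO := s.sO ++ outs.map .tup }
  | deliverWatermark (s : State α) (w : ℕ) (a : AggState (EVal α) (ETup α))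
      (outs : List (Tup α)) (hw : s.sA2[s.rd2]? = some (.wm w))
      (hA : (A₂ δ).OnWatermark δ s.a2 w a outs) :
      Step u δ L S .deliver s
        { s with rd2 := s.rd2 + 1, a2 := a, sO := s.sO ++ outs.map .tup ++ [.wm w] }

/-- An infinite execution: the sequence of states and the actions taken. -/
def IsExecution {α : Type*} [DecidableEq α] (u : UnionReading) (δ L : ℕ)
    (S : ℕ → Item (ETup α)) (act : ℕ → Act) (run : ℕ → State α) : Prop :=
  run 0 = State.init α ∧ ∀ n, Step u δ L S (act n) (run n) (run (n + 1))

/-- Watermark `w` does not prevent any tuple that is still in the loop from being processed. -/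
def LoopSafe {α : Type*} [DecidableEq α] (u : UnionReading) (δ L : ℕ) (s : State α) (w : ℕ) :
    Prop :=
  ∀ (t : ETup α) (v : ℕ), Item.tup (t, v) ∈ s.sA2.drop s.rd1 →
    ∀ ℓ, (A₁ (α := α) u δ L).Falls t ℓ → (A₁ (α := α) u δ L).Accepts w ℓ

/-- Condition C2 for the first Aggregate: it updates its watermark to `w` only once `w` does not
prevent any tuple still in the loop from being processed. -/
def C2 {α : Type*} [DecidableEq α] (u : UnionReading) (δ L : ℕ) (act : ℕ → Act)
    (run : ℕ → State α) : Prop :=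
  ∀ n w ws, act n = .update → (run n).pend = w :: ws → LoopSafe u δ L (run n) w

/-- Condition C3 for the first Aggregate: watermark `w` is fed downstream after all tuples of
`trig(w)` and all their successors. -/
def C3 {α : Type*} (run : ℕ → State α) : Prop :=
  ∀ (n i j w : ℕ) (t : ETup α),
    (run n).sA2[i]? = some (.wm w) → (run n).sA2[j]? = some (.tup (t, w)) → j < i

/-- The action is possible and not held back: a watermark update may wait for the loop as C2
demands, and the forwarding of `w` may wait until no tuple of `trig(w)` and no successor of such a
tuple is left in the loop. -/
def Ready {α : Type*} [DecidableEq α] (u : UnionReading) (δ L : ℕ) (s : State α) : Act → Prop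
  | .source => True
  | .update => ∃ w ws, s.pend = w :: ws ∧ LoopSafe u δ L s w
  | .loop => s.rd1 < s.sA2.length
  | .forward => ∃ w ws, s.fwd = w :: ws ∧ ∀ t, Item.tup (t, w) ∉ s.sA2.drop s.rd1
  | .deliver => s.rd2 < s.sA2.length

/-- Weak fairness: no action is ready forever without being taken. -/
def Fair {α : Type*} [DecidableEq α] (u : UnionReading) (δ L : ℕ) (act : ℕ → Act)
    (run : ℕ → State α) : Prop :=
  ∀ a n, ∃ m, n ≤ m ∧ (act m = a ∨ ¬ Ready u δ L (run m) a)

end Streaming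

/-!
All windows have size `δ` and all attributes are the key, so a window instance only ever holds
copies of one tuple (`Stores`). In the stream `S_E` all copies of a tuple `k = ⟨τ, T, -1⟩` arrive
before the first watermark `w ≥ τ + δ`; the update to `w` therefore outputs one tuple
`⟨τ, T', 0⟩`, with `T'` the union of all copies of `T` (`link S u k 0`). This tuple is late when it
comes back through the loop, so its successor `⟨τ, T', 1⟩` is output at once, and so on up to
`⟨τ, T', |T'|⟩`, where the chain ends.

Safety. `LoopInv` states that the output stream of the first Aggregate consists of initial segments
of these chains, without repetitions: `T` is recovered from `T'` by removing repetitions, so chains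
of different tuples are disjoint (`link_inj`). No looping tuple comes too late: C1 and `D ≤ L`
bound the first watermark that closes a window (`C1.lt_add`), and C2 delays the later ones. The
second Aggregate receives `⟨τ, T', i⟩` before any watermark `≥ τ + δ`: the first such watermark
is the one that triggered the chain, and C3 keeps it back (`LoopInv.wm2_lt`). So the window of this
tuple outputs `T'[i]` exactly once, when a watermark `≥ τ + δ` arrives (`OutputInv`).

Liveness. Every log entry is eventually read. Each reading of a looping tuple decreases a weight
that bounds the rest of its chain, so the loop drains while the first Aggregate does not update,
and it always runs out of tuples that stem from any one watermark (`FairRun.drain`). Hence neither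
an update nor a forwarding stays blocked, every watermark reaches the second Aggregate, and every
chain is completed and delivered.

The eventual number of copies of `x` in the output is thus the sum, over the distinct input tuples
`k` with timestamp `x.τ`, of the number of copies of `x.val` in `T'`
(`FairRun.eventually_count_sO`), and this is what Unfold emits when `T'` has as many copies of an
element as the copies of `k` have together.
-/

namespace Streaming

/-! ### Lists -/

theorem le_foldl_max {l : List ℕ} {w : ℕ} (h : w ∈ l) : w ≤ l.foldl max 0 := by
  have key : ∀ (l : List ℕ) (a : ℕ), a ≤ l.foldl max a ∧ ∀ w ∈ l, w ≤ l.foldl max a := by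
    intro l
    induction l with
    | nil => simp
    | cons b l ih =>
      intro a
      obtain ⟨h1, h2⟩ := ih (max a b)
      refine ⟨(le_max_left a b).trans h1, fun w hw => ?_⟩
      rcases List.mem_cons.1 hw with rfl | hw
      · exact (le_max_right a w).trans h1
      · exact h2 w hw
  exact (key l 0).2 w h

theorem foldl_max_eq_zero_or_mem (l : List ℕ) : l.foldl max 0 = 0 ∨ l.foldl max 0 ∈ l := by
  induction l using List.reverseRecOn with
  | nil => simp
  | append_singleton l a ih =>
    rw [List.foldl_append, List.foldl_cons, List.foldl_nil]
    rcases max_cases (l.foldl max 0) a with ⟨h, -⟩ | ⟨h, -⟩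
    · rw [h]
      exact ih.imp id fun h => List.mem_append_left _ h
    · rw [h]
      exact Or.inr (by simp)

theorem foldl_max_le {l : List ℕ} {b : ℕ} (h : ∀ w ∈ l, w ≤ b) : l.foldl max 0 ≤ b := by
  rcases foldl_max_eq_zero_or_mem l with h0 | h0
  · omega
  · exact h _ h0

theorem exists_le_of_le_foldl_max {l : List ℕ} {b : ℕ} (hb : 0 < b) (h : b ≤ l.foldl max 0) :
    ∃ w ∈ l, b ≤ w := by
  rcases foldl_max_eq_zero_or_mem l with h0 | h0
  · omega
  · exact ⟨_, h0, h⟩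

theorem Enumerates.eq_nil {ι : Type*} {l : List ι} {p : ι → Prop} (h : Enumerates l p)
    (hp : ∀ i, ¬ p i) : l = [] :=
  List.eq_nil_iff_forall_not_mem.2 fun i hi => hp i ((h.2 i).1 hi)

theorem Enumerates.perm {ι : Type*} {l l' : List ι} {p : ι → Prop} (h : Enumerates l p)
    (h' : Enumerates l' p) : l.Perm l' :=
  (List.perm_ext_iff_of_nodup h.1 h'.1).2 fun i => (h.2 i).trans (h'.2 i).symm

theorem count_eq_card_range {α : Type*} [DecidableEq α] (l : List α) (v : α) :
    l.count v = ((Finset.range l.length).filter fun i => l[i]? = some v).card := by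
  induction l using List.reverseRecOn with
  | nil => simp
  | append_singleton l a ih =>
    have hl : ((Finset.range l.length).filter fun i => (l ++ [a])[i]? = some v) =
        (Finset.range l.length).filter fun i => l[i]? = some v :=
      Finset.filter_congr fun i hi => by
        rw [List.getElem?_append_left (Finset.mem_range.1 hi)]
    rw [List.count_append, List.length_append, List.length_singleton, Finset.range_add_one,
      Finset.filter_insert, hl, ih]
    by_cases h : a = v <;> simp [h]

/-! ### Unions of copies of a list -/

section Union

variable {α : Type*} [DecidableEq α]

/-- The union of `n` copies of `T` in the given reading: `n`-fold concatenation, or `T` itself. The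
value for `n = 0` in the second reading is irrelevant. -/
def unionPow (u : UnionReading) (n : ℕ) (T : List α) : List α :=
  match u with
  | .bag => (List.replicate n T).flatten
  | .set => T

theorem self_union (T : List α) : T ∪ T = T :=
  List.Subset.union_eq_right (List.Subset.refl T)

theorem foldl_union_replicate (u : UnionReading) {n : ℕ} (hn : 0 < n) (t : ETup α) :
    (List.replicate n t).foldl (fun T t' => u.union T t'.val.1) [] = unionPow u n t.val.1 := by
  obtain ⟨n, rfl⟩ := Nat.exists_eq_succ_of_ne_zero hn.ne'
  clear hn
  induction n with
  | zero => cases u <;> simp [UnionReading.union, unionPow]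
  | succ n ih =>
    rw [List.replicate_succ', List.foldl_append, ih]
    cases u
    · simp only [UnionReading.union, unionPow, List.foldl_cons, List.foldl_nil]
      rw [List.replicate_succ' (n := n.succ)]
      simp
    · simp [UnionReading.union, unionPow, self_union]

/-- `T` can be recovered from a union of copies of `T`. -/
theorem dedup_unionPow (u : UnionReading) {n : ℕ} (hn : 0 < n) {T : List α} (hT : T.Nodup) :
    (unionPow u n T).dedup = T := by
  obtain ⟨n, rfl⟩ := Nat.exists_eq_succ_of_ne_zero hn.ne'
  clear hn
  cases u
  · induction n with
    | zero => simpa [unionPow] using hT.dedup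
    | succ n ih =>
      simp only [unionPow] at ih ⊢
      rw [List.replicate_succ, List.flatten_cons, List.dedup_append, ih, self_union]
  · exact hT.dedup

omit [DecidableEq α] in
theorem mem_unionPow (u : UnionReading) {n : ℕ} (hn : 0 < n) {T : List α} {a : α} :
    a ∈ unionPow u n T ↔ a ∈ T := by
  cases u
  · simp [unionPow, hn.ne']
  · exact Iff.rfl

theorem count_unionPow (u : UnionReading) {n : ℕ} (h : u = .bag ∨ n = 1) (T : List α) (a : α) :
    (unionPow u n T).count a = n * T.count a := by
  cases u
  · simp [unionPow, List.count_flatten]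
  · simp_all [unionPow]

end Union

/-! ### Tuples and watermarks of an input stream -/

section Stream

variable {V : Type*}

/-- The tuples among the first `p` items. -/
def recv (S : ℕ → Item (Tup V)) (p : ℕ) : List (Tup V) :=
  (List.range p).filterMap fun i => match S i with
    | .tup t => some t
    | .wm _ => none

/-- The watermarks among the first `p` items. -/
def wmsIn (S : ℕ → Item (Tup V)) (p : ℕ) : List ℕ :=
  (List.range p).filterMap fun i => match S i with
    | .tup _ => none
    | .wm w => some w

variable {S : ℕ → Item (Tup V)} {p : ℕ}

theorem mem_recv {t : Tup V} : t ∈ recv S p ↔ ∃ i < p, S i = .tup t := by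
  simp only [recv, List.mem_filterMap, List.mem_range]
  refine exists_congr fun i => and_congr_right fun _ => ?_
  cases S i <;> simp

theorem mem_wmsIn {w : ℕ} : w ∈ wmsIn S p ↔ ∃ i < p, S i = .wm w := by
  simp only [wmsIn, List.mem_filterMap, List.mem_range]
  refine exists_congr fun i => and_congr_right fun _ => ?_
  cases S i <;> simp

theorem recv_succ_tup {t : Tup V} (h : S p = .tup t) : recv S (p + 1) = recv S p ++ [t] := by
  simp [recv, List.range_succ, h]

theorem recv_succ_wm {w : ℕ} (h : S p = .wm w) : recv S (p + 1) = recv S p := by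
  simp [recv, List.range_succ, h]

theorem wmsIn_succ_tup {t : Tup V} (h : S p = .tup t) : wmsIn S (p + 1) = wmsIn S p := by
  simp [wmsIn, List.range_succ, h]

theorem wmsIn_succ_wm {w : ℕ} (h : S p = .wm w) : wmsIn S (p + 1) = wmsIn S p ++ [w] := by
  simp [wmsIn, List.range_succ, h]

theorem wmsIn_prefix {q : ℕ} (h : p ≤ q) : wmsIn S p <+: wmsIn S q := by
  induction q, h using Nat.le_induction with
  | base => exact List.prefix_rfl
  | succ q _ ih =>
    refine ih.trans ?_
    cases hS : S q with
    | tup t => rw [wmsIn_succ_tup hS]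
    | wm w => rw [wmsIn_succ_wm hS]; exact List.prefix_append _ _

theorem WatermarksSound.le_wm (hW : WatermarksSound S) {w w' : ℕ} (h : w ∈ wmsIn S p) {j : ℕ}
    (hj : p ≤ j) (h' : S j = .wm w') : w ≤ w' := by
  obtain ⟨i, hi, hS⟩ := mem_wmsIn.1 h
  exact (hW i j (hi.trans_le hj) w hS).1 w' h'

theorem WatermarksSound.le_τ (hW : WatermarksSound S) {w : ℕ} {t : Tup V} (h : w ∈ wmsIn S p)
    {j : ℕ} (hj : p ≤ j) (h' : S j = .tup t) : w ≤ t.τ := by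
  obtain ⟨i, hi, hS⟩ := mem_wmsIn.1 h
  exact (hW i j (hi.trans_le hj) w hS).2 t h'

theorem WatermarksSound.pairwise (hW : WatermarksSound S) (p : ℕ) :
    (wmsIn S p).Pairwise (· ≤ ·) := by
  induction p with
  | zero => simp [wmsIn]
  | succ p ih =>
    cases hS : S p with
    | tup t => rwa [wmsIn_succ_tup hS]
    | wm w =>
      rw [wmsIn_succ_wm hS, List.pairwise_append]
      refine ⟨ih, by simp, fun a ha b hb => ?_⟩
      rw [List.mem_singleton.1 hb]
      exact hW.le_wm ha le_rfl hS

/-- The first watermark that reaches `b` exceeds it by less than `D`, provided that a tuple with a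
timestamp smaller than `b` has been seen. -/
theorem C1.lt_add {D : ℕ} (hC1 : C1 S D) (hW : WatermarksSound S) {t : Tup V} {i b j w : ℕ}
    (ht : S i = .tup t) (htb : t.τ < b) (hw : S j = .wm w) (hbw : b ≤ w)
    (hfirst : ∀ j' w', S j' = .wm w' → w' < b ∨ w ≤ w') : w < b + D := by
  classical
  have hex : ∃ j, S j = .wm w := ⟨j, hw⟩
  set m := Nat.find hex
  have hm : S m = .wm w := Nat.find_spec hex
  have him : i < m := by
    rcases lt_trichotomy i m with h | h | h
    · exact h
    · rw [h, hm] at ht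
      cases ht
    · have := (hW m i h w hm).2 t ht
      omega
  by_cases hprev : ∃ k, k < m ∧ ∃ v, S k = .wm v
  · -- the last watermark before the first occurrence of `w`
    obtain ⟨k, ⟨hkm, v, hv⟩, hmax⟩ : ∃ k, (k < m ∧ ∃ v, S k = .wm v) ∧
        ∀ k', (k' < m ∧ ∃ v, S k' = .wm v) → k' ≤ k := by
      obtain ⟨k0, hk0⟩ := hprev
      refine ⟨Nat.findGreatest (fun k => k < m ∧ ∃ v, S k = .wm v) m,
        Nat.findGreatest_spec (P := fun k => k < m ∧ ∃ v, S k = .wm v) hk0.1.le hk0,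
        fun k' hk' => Nat.le_findGreatest hk'.1.le hk'⟩
    have h1 := hC1.consecutive k m v w hkm hv hm fun k' v' h h' he =>
      absurd (hmax k' ⟨h', v', he⟩) (by omega)
    have h2 : v ≤ w := (hW k m hkm v hv).1 w hm
    have h3 : v ≠ w := fun h => Nat.find_min hex hkm (h ▸ hv)
    rcases hfirst k v hv with h | h <;> omega
  · have := hC1.first m w hm (fun k v hk he => hprev ⟨k, hk, v, he⟩) i t him ht
    omega

/-- The number of occurrences of `k` in the stream. -/
noncomputable def mult (S : ℕ → Item (Tup V)) (k : Tup V) : ℕ :=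
  {i | S i = .tup k}.ncard

theorem count_recv [DecidableEq V] (S : ℕ → Item (Tup V)) (p : ℕ) (k : Tup V) :
    (recv S p).count k = ((Finset.range p).filter fun i => S i = .tup k).card := by
  induction p with
  | zero => simp [recv]
  | succ p ih =>
    rw [Finset.range_add_one, Finset.filter_insert]
    cases hS : S p with
    | tup t =>
      rw [recv_succ_tup hS, List.count_append, ih]
      by_cases h : t = k
      · simp [h]
      · simp [h]
    | wm w => rw [recv_succ_wm hS, ih]; simp

theorem WatermarksSound.count_recv_eq_mult [DecidableEq V] (hW : WatermarksSound S) {w : ℕ}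
    {k : Tup V} (hw : w ∈ wmsIn S p) (hk : k.τ < w) : (recv S p).count k = mult S k := by
  rw [count_recv, mult, ← Set.ncard_coe_finset]
  congr 1
  ext i
  simp only [Finset.coe_filter, Finset.mem_range, Set.mem_ofPred_eq, and_iff_right_iff_imp]
  intro h
  by_contra hi
  have := hW.le_τ hw (not_lt.1 hi) h
  omega

end Stream

/-! ### Tumbling windows keyed by all attributes -/

section Tumbling

variable {V O : Type*} {δ : ℕ}

/-- The Aggregate has windows of size and advance `δ` and all attributes as key. -/
structure Agg.IsTumbling (A : Agg V (Tup V) O) (δ : ℕ) : Prop where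
  WA : A.WA = δ
  WS : A.WS = δ
  key : A.key = id

theorem isTumbling_A₁ {α : Type*} [DecidableEq α] (u : UnionReading) (δ L : ℕ) :
    (A₁ (α := α) u δ L).IsTumbling δ := ⟨rfl, rfl, rfl⟩

theorem isTumbling_A₂ {α : Type*} (δ : ℕ) : (A₂ (α := α) δ).IsTumbling δ := ⟨rfl, rfl, rfl⟩

variable {A : Agg V (Tup V) O}

theorem Agg.IsTumbling.right (hA : A.IsTumbling δ) (ℓ : ℕ) : A.right ℓ = ℓ * δ + δ := by
  rw [Agg.right, Agg.left, hA.WA, hA.WS]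

theorem Agg.IsTumbling.falls_iff (hA : A.IsTumbling δ) (hδ : 0 < δ) {t : Tup V} {ℓ : ℕ} :
    A.Falls t ℓ ↔ ℓ = t.τ / δ := by
  rw [Agg.Falls, hA.right, Agg.left, hA.WA, eq_comm, Nat.div_eq_iff hδ]
  have : 0 < ℓ * δ + δ := by positivity
  omega

/-- The state's window instances hold exactly the tuples of `l`. As all attributes are the key, the
window instance of key `k` consists of copies of `k`. -/
def Stores [DecidableEq V] (δ : ℕ) (s : AggState V (Tup V)) (l : List (Tup V)) : Prop :=
  ∀ ℓ k, s.win ℓ k = if ℓ = k.τ / δ then List.replicate (l.count k) k else []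

/-- The result of the window instance that holds `n` copies of `k`, for `k.τ` a multiple of the
window size. -/
def Agg.copiesResult (A : Agg V (Tup V) O) (k : Tup V) (n : ℕ) : Option (Tup O) :=
  (A.fO ⟨k.τ, List.replicate n k⟩).map (Tup.mk k.τ)

variable [DecidableEq V]

theorem stores_init : Stores δ (AggState.init V (Tup V)) [] := by
  simp [Stores, AggState.init]

theorem Stores.perm {s : AggState V (Tup V)} {l l' : List (Tup V)} (h : Stores δ s l)
    (hl : l.Perm l') : Stores δ s l' := fun ℓ k => by rw [h ℓ k, hl.count_eq]

theorem Agg.IsTumbling.result_eq (hA : A.IsTumbling δ) {s : AggState V (Tup V)}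
    {l : List (Tup V)} (h : Stores δ s l) {k : Tup V} (hk : δ ∣ k.τ) :
    A.result δ s (k.τ / δ) k = A.copiesResult k (l.count k) := by
  rw [Agg.result, h, hA.right, Agg.left, hA.WA, Nat.div_mul_cancel hk, Nat.add_sub_cancel,
    if_pos rfl, Agg.copiesResult]

theorem Agg.IsTumbling.stores_add (hA : A.IsTumbling δ) (hδ : 0 < δ) {s : AggState V (Tup V)}
    {l : List (Tup V)} (h : Stores δ s l) {t : Tup V} (ht : δ ∣ t.τ)
    (hacc : s.wm < t.τ + δ + A.L) : Stores δ (A.add s t) (l ++ [t]) := by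
  intro ℓ k
  have hacc' : A.Accepts s.wm (t.τ / δ) := by
    rwa [Agg.Accepts, hA.right, Nat.div_mul_cancel ht]
  have hiff : k = A.key t ∧ A.Falls t ℓ ∧ A.Accepts s.wm ℓ ↔ k = t ∧ ℓ = t.τ / δ := by
    rw [hA.key, hA.falls_iff hδ, id]
    refine and_congr_right fun _ => and_iff_left_of_imp ?_
    rintro rfl
    exact hacc'
  have hadd : (A.add s t).win ℓ k =
      if k = t ∧ ℓ = t.τ / δ then s.win ℓ k ++ [t] else s.win ℓ k := by
    by_cases hc : k = t ∧ ℓ = t.τ / δ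
    · rw [if_pos hc]
      exact if_pos (hiff.2 hc)
    · rw [if_neg hc]
      exact if_neg (hiff.not.2 hc)
  rw [hadd, h ℓ k]
  by_cases hk : k = t
  · subst hk
    by_cases hℓ : ℓ = k.τ / δ
    · simp [hℓ, List.replicate_succ']
    · simp [hℓ]
  · simp [hk, Ne.symm hk]

/-- Processing an accepted tuple: it is stored, and the result of its window instance is output at
once if the tuple is late. -/
theorem Agg.IsTumbling.onTuple (hA : A.IsTumbling δ) (hδ : 0 < δ) {s s' : AggState V (Tup V)}
    {l : List (Tup V)} (h : Stores δ s l) {t : Tup V} (ht : δ ∣ t.τ)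
    (hacc : s.wm < t.τ + δ + A.L) {outs : List (Tup O)} (hs : A.OnTuple δ s t s' outs) :
    s'.wm = s.wm ∧ Stores δ s' (l ++ [t]) ∧
      outs = if t.τ + δ ≤ s.wm then (A.copiesResult t (l.count t + 1)).toList else [] := by
  obtain ⟨rfl, ls, hls, rfl⟩ := hs
  have hst := hA.stores_add hδ h ht hacc
  refine ⟨rfl, hst, ?_⟩
  have hright : A.right (t.τ / δ) = t.τ + δ := by rw [hA.right, Nat.div_mul_cancel ht]
  split_ifs with hlate
  · have : ls = [t.τ / δ] := by
      refine List.perm_singleton.1 (hls.perm ⟨List.nodup_singleton _, fun ℓ => ?_⟩)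
      rw [List.mem_singleton]
      change _ ↔ A.Falls t ℓ ∧ _
      rw [hA.falls_iff hδ]
      constructor
      · rintro rfl
        exact ⟨rfl, by rwa [Agg.Accepts, hright], by rwa [hright]⟩
      · exact fun h => h.1
    rw [this, hA.key, List.filterMap_cons, List.filterMap_nil, id, hA.result_eq hst ht,
      List.count_append, List.count_singleton_self]
    cases A.copiesResult t (l.count t + 1) <;> rfl
  · rw [hls.eq_nil, List.filterMap_nil]
    rintro ℓ ⟨h1, -, h2⟩
    rw [(hA.falls_iff hδ).1 h1, hright] at h2
    exact hlate h2

/-- Processing a watermark: one result is output for each tuple whose window is newly reached. -/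
theorem Agg.IsTumbling.onWatermark (hA : A.IsTumbling δ) {s s' : AggState V (Tup V)}
    {l : List (Tup V)} (h : Stores δ s l) (hl : ∀ t ∈ l, δ ∣ t.τ) {w : ℕ} {outs : List (Tup O)}
    (hs : A.OnWatermark δ s w s' outs) :
    s'.wm = max s.wm w ∧ Stores δ s' l ∧
      outs.Perm ((l.dedup.filter fun k => s.wm < k.τ + δ ∧ k.τ + δ ≤ max s.wm w).filterMap
        fun k => A.copiesResult k (l.count k)) := by
  obtain ⟨rfl, ws, hws, rfl⟩ := hs
  refine ⟨rfl, h, ?_⟩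
  set K := l.dedup.filter fun k => s.wm < k.τ + δ ∧ k.τ + δ ≤ max s.wm w with hK
  have hKl : ∀ k ∈ K, k ∈ l := fun k hk => List.mem_dedup.1 (List.mem_of_mem_filter hk)
  have hp : ws.Perm (K.map fun k => (k.τ / δ, k)) := by
    refine hws.perm ⟨?_, ?_⟩
    · exact ((List.nodup_dedup l).filter _).map fun a b hab => (Prod.ext_iff.1 hab).2
    · rintro ⟨ℓ, k⟩
      have hwin : s.win ℓ k ≠ [] ↔ ℓ = k.τ / δ ∧ k ∈ l := by
        rw [h ℓ k]
        split_ifs with hc <;> simp [hc, List.replicate_eq_nil_iff, List.count_eq_zero]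
      simp only [List.mem_map, Prod.mk.injEq, hK, List.mem_filter, List.mem_dedup,
        decide_eq_true_eq]
      rw [hwin]
      constructor
      · rintro ⟨k', ⟨h1, h2, h3⟩, rfl, rfl⟩
        rw [hA.right, Nat.div_mul_cancel (hl _ h1)]
        exact ⟨⟨rfl, h1⟩, h2, h3⟩
      · rintro ⟨⟨rfl, h1⟩, h2, h3⟩
        rw [hA.right, Nat.div_mul_cancel (hl _ h1)] at h2 h3
        exact ⟨k, ⟨h1, h2, h3⟩, rfl, rfl⟩
  refine (hp.filterMap _).trans (List.Perm.of_eq ?_)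
  rw [List.filterMap_map]
  refine List.filterMap_congr fun k hk => ?_
  exact hA.result_eq (s := { s with wm := max s.wm w }) h (hl k (hKl k hk))

end Tumbling

/-! ### The values that circulate in the loop -/

section Links

variable {α : Type*}

/-- What the first Aggregate outputs upon receiving a looping tuple. -/
def next (t : ETup α) : Option (ETup α) :=
  if t.val.2 < (t.val.1.length : ℤ) then some ⟨t.τ, (t.val.1, t.val.2 + 1)⟩ else none

/-- The tuple that the second Aggregate extracts from a looping tuple. -/
def extract (t : ETup α) : Option (Tup α) :=
  (if 0 ≤ t.val.2 then t.val.1[t.val.2.toNat]? else none).map (Tup.mk t.τ)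

/-- The collection that the first Aggregate puts into the loop for the input tuple `k`. -/
noncomputable def embedded (S : ℕ → Item (ETup α)) (u : UnionReading) (k : ETup α) : List α :=
  unionPow u (mult S k) k.val.1

/-- The looping tuple with index `i` that stems from the input tuple `k`. -/
noncomputable def link (S : ℕ → Item (ETup α)) (u : UnionReading) (k : ETup α) (i : ℕ) : ETup α :=
  ⟨k.τ, (embedded S u k, i)⟩

theorem next_eq_some {t x : ETup α} (h : next t = some x) :
    t.val.2 < (t.val.1.length : ℤ) ∧ x = ⟨t.τ, (t.val.1, t.val.2 + 1)⟩ := by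
  unfold next at h
  split_ifs at h with hc
  exact ⟨hc, (Option.some.inj h).symm⟩

theorem next_inj {t t' x : ETup α} (h : next t = some x) (h' : next t' = some x) : t = t' := by
  obtain ⟨-, rfl⟩ := next_eq_some h
  obtain ⟨-, h'⟩ := next_eq_some h'
  obtain ⟨τ, T, i⟩ := t
  obtain ⟨τ', T', i'⟩ := t'
  simp only [Tup.mk.injEq, Prod.mk.injEq, add_left_inj] at h' ⊢
  exact h'

variable {S : ℕ → Item (ETup α)} {u : UnionReading}

theorem next_link {k : ETup α} {i : ℕ} (h : i < (embedded S u k).length) :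
    next (link S u k i) = some (link S u k (i + 1)) := by
  simp [next, link, h]

theorem extract_link (k : ETup α) (i : ℕ) :
    extract (link S u k i) = ((embedded S u k)[i]?).map (Tup.mk k.τ) := by
  simp [extract, link]

theorem extract_τ {t : ETup α} {x : Tup α} (h : extract t = some x) : t.τ = x.τ := by
  obtain ⟨v, -, rfl⟩ := Option.map_eq_some_iff.1 h
  rfl

theorem copiesResult_A₂ {δ : ℕ} {t : ETup α} {n : ℕ} (hn : 0 < n) :
    (A₂ δ).copiesResult t n = extract t := by
  obtain ⟨n, rfl⟩ := Nat.exists_eq_succ_of_ne_zero hn.ne'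
  rfl

variable [DecidableEq α]

theorem copiesResult_A₁_loop {δ L : ℕ} {t : ETup α} (ht : t.val.2 ≠ -1) {n : ℕ} (hn : 0 < n) :
    (A₁ u δ L).copiesResult t n = next t := by
  obtain ⟨n, rfl⟩ := Nat.exists_eq_succ_of_ne_zero hn.ne'
  simp only [Agg.copiesResult, A₁, fO₁, List.replicate_succ, if_neg ht, next]
  split_ifs <;> rfl

theorem copiesResult_A₁_input {δ L : ℕ} {t : ETup α} (ht : t.val.2 = -1) {n : ℕ} (hn : 0 < n) :
    (A₁ u δ L).copiesResult t n = some ⟨t.τ, (unionPow u n t.val.1, 0)⟩ := by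
  rw [← foldl_union_replicate u hn t]
  obtain ⟨n, rfl⟩ := Nat.exists_eq_succ_of_ne_zero hn.ne'
  simp [Agg.copiesResult, A₁, fO₁, List.replicate_succ, ht]

theorem mult_pos_of_count {p : ℕ} {k : ETup α} (hk : k ∈ recv S p)
    (h : (recv S p).count k = mult S k) : 0 < mult S k :=
  h ▸ List.count_pos_iff.2 hk

/-- Distinct input tuples give rise to distinct looping tuples. -/
theorem link_inj {δ : ℕ} (hE : IsEmbedStream δ S) {p : ℕ} {k k' : ETup α} {i i' : ℕ}
    (hk : k ∈ recv S p) (hk' : k' ∈ recv S p) (hm : 0 < mult S k) (hm' : 0 < mult S k')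
    (h : link S u k i = link S u k' i') : k = k' ∧ i = i' := by
  obtain ⟨j, -, hj⟩ := mem_recv.1 hk
  obtain ⟨j', -, hj'⟩ := mem_recv.1 hk'
  obtain ⟨-, hn, hi⟩ := hE j k hj
  obtain ⟨-, hn', hi'⟩ := hE j' k' hj'
  simp only [link, Tup.mk.injEq, Prod.mk.injEq, Nat.cast_inj] at h
  obtain ⟨h1, h2, h3⟩ := h
  refine ⟨?_, h3⟩
  have h4 : k.val.1 = k'.val.1 := by
    rw [← dedup_unionPow u hm hn, ← dedup_unionPow u hm' hn']
    exact congrArg List.dedup h2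
  cases k
  cases k'
  exact congrArg₂ Tup.mk h1 (Prod.ext h4 (hi.trans hi'.symm))

end Links

/-! ### Logs -/

section Log

variable {β : Type*}

/-- The watermarks in a log. -/
def wmsOf (l : List (Item (β × ℕ))) : List ℕ :=
  l.filterMap fun x =>
    match x with
    | .tup _ => none
    | .wm w => some w

theorem wmsOf_append (l l' : List (Item (β × ℕ))) : wmsOf (l ++ l') = wmsOf l ++ wmsOf l' :=
  List.filterMap_append ..

theorem tuplesOf_append (l l' : List (Item (β × ℕ))) :
    tuplesOf (l ++ l') = tuplesOf l ++ tuplesOf l' :=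
  List.filterMap_append ..

theorem wmsOf_entries (outs : List β) (w : ℕ) : wmsOf (entries outs w) = [] := by
  simp [wmsOf, entries]

theorem tuplesOf_entries (outs : List β) (w : ℕ) : tuplesOf (entries outs w) = outs := by
  induction outs with
  | nil => rfl
  | cons a l ih => exact congrArg (a :: ·) ih

theorem wmsOf_wm (w : ℕ) : wmsOf ([.wm w] : List (Item (β × ℕ))) = [w] := rfl

theorem mem_wmsOf {l : List (Item (β × ℕ))} {w : ℕ} : w ∈ wmsOf l ↔ Item.wm w ∈ l := by
  simp only [wmsOf, List.mem_filterMap]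
  constructor
  · rintro ⟨x, hx, h⟩
    cases x <;> simp_all
  · exact fun h => ⟨_, h, rfl⟩

theorem mem_tuplesOf {l : List (Item (β × ℕ))} {t : β} :
    t ∈ tuplesOf l ↔ ∃ v, Item.tup (t, v) ∈ l := by
  simp only [tuplesOf, List.mem_filterMap]
  constructor
  · rintro ⟨x, hx, h⟩
    cases x <;> simp_all
    subst h
    exact ⟨_, hx⟩
  · rintro ⟨v, h⟩
    exact ⟨_, h, rfl⟩

theorem mem_entries {outs : List β} {w : ℕ} {t : β} {v : ℕ} :
    Item.tup (t, v) ∈ entries outs w ↔ t ∈ outs ∧ v = w := by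
  simp only [entries, List.mem_map, Item.tup.injEq, Prod.mk.injEq]
  constructor
  · rintro ⟨_, h, rfl, rfl⟩
    exact ⟨h, rfl⟩
  · rintro ⟨h, rfl⟩
    exact ⟨_, h, rfl, rfl⟩

theorem take_succ_of_getElem? {γ : Type*} {l : List γ} {i : ℕ} {x : γ} (h : l[i]? = some x) :
    l.take (i + 1) = l.take i ++ [x] := by
  rw [List.take_add_one, h]
  rfl

theorem drop_of_getElem? {γ : Type*} {l : List γ} {i : ℕ} {x : γ} (h : l[i]? = some x) :
    l.drop i = x :: l.drop (i + 1) := by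
  obtain ⟨hi, rfl⟩ := List.getElem?_eq_some_iff.1 h
  exact List.drop_eq_getElem_cons hi

theorem mem_of_take {l : List (Item (β × ℕ))} {i : ℕ} {x : β}
    (hx : x ∈ tuplesOf (l.take i)) : x ∈ tuplesOf l :=
  ((List.take_sublist i l).filterMap _).subset hx

end Log

/-! ### Watermarks along an execution -/

section Invariants

variable {α : Type*} {u : UnionReading} {δ D L : ℕ} {S : ℕ → Item (ETup α)}
  {s s' : State α} {a : Act}

/-- Watermarks are used, forwarded and delivered in the order of the input stream. -/
structure Bookkeeping (S : ℕ → Item (ETup α)) (s : State α) : Prop where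
  wms : wmsOf s.sA2 ++ s.fwd ++ s.pend = wmsIn S s.pos
  wm1 : s.a1.wm = (wmsOf s.sA2 ++ s.fwd).foldl max 0
  wm2 : s.a2.wm = (wmsOf (s.sA2.take s.rd2)).foldl max 0
  rd1_le : s.rd1 ≤ s.sA2.length
  rd2_le : s.rd2 ≤ s.sA2.length

theorem bookkeeping_init : Bookkeeping S (State.init α) := by
  constructor <;> simp [State.init, wmsOf, wmsIn, AggState.init]

theorem Bookkeeping.used_subset (h : Bookkeeping S s) {w : ℕ} (hw : w ∈ wmsOf s.sA2 ++ s.fwd) :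
    w ∈ wmsIn S s.pos :=
  h.wms ▸ List.mem_append_left _ hw

theorem Bookkeeping.wm1_le_τ (h : Bookkeeping S s) (hW : WatermarksSound S) {t : ETup α}
    (ht : S s.pos = .tup t) : s.a1.wm ≤ t.τ := by
  rw [h.wm1]
  exact foldl_max_le fun w hw => hW.le_τ (h.used_subset hw) le_rfl ht

theorem Bookkeeping.wm1_le_pend (h : Bookkeeping S s) (hW : WatermarksSound S) {w : ℕ}
    {ws : List ℕ} (hw : s.pend = w :: ws) : s.a1.wm ≤ w := by
  rw [h.wm1]
  refine foldl_max_le fun w' hw' => ?_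
  have := hW.pairwise s.pos
  rw [← h.wms, List.pairwise_append] at this
  exact this.2.2 w' hw' w (by simp [hw])

/-- A watermark that closes the window of a received tuple leaves the window open for late
tuples. -/
theorem Bookkeeping.pend_lt (h : Bookkeeping S s) (hW : WatermarksSound S) (hC1 : C1 S D)
    (hδ : 0 < δ) {k : ETup α} (hk : k ∈ recv S s.pos) {w : ℕ} {ws : List ℕ}
    (hw : s.pend = w :: ws) (h1 : s.a1.wm < k.τ + δ) (h2 : k.τ + δ ≤ w) : w < k.τ + δ + D := by
  obtain ⟨i, hi, hS⟩ := mem_recv.1 hk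
  have hwin : w ∈ wmsIn S s.pos := by simp [← h.wms, hw]
  obtain ⟨j, hj, hSw⟩ := mem_wmsIn.1 hwin
  refine hC1.lt_add hW hS (by omega) hSw h2 fun j' w' hj' => ?_
  rcases lt_or_ge j' s.pos with hlt | hge
  · have hmem : w' ∈ wmsIn S s.pos := mem_wmsIn.2 ⟨j', hlt, hj'⟩
    have hsort := hW.pairwise s.pos
    rw [← h.wms] at hmem hsort
    rcases List.mem_append.1 hmem with hm | hm
    · have := le_foldl_max hm
      rw [← h.wm1] at this
      omega
    · rw [hw] at hm hsort
      rcases List.mem_cons.1 hm with rfl | hm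
      · exact Or.inr le_rfl
      · exact Or.inr ((List.pairwise_cons.1 (List.pairwise_append.1 hsort).2.1).1 _ hm)
  · exact Or.inr (hW.le_wm hwin hge hj')

variable [DecidableEq α]

theorem Bookkeeping.step (h : Bookkeeping S s) (hs : Step u δ L S a s s') : Bookkeeping S s' := by
  obtain ⟨h1, h2, h3, h4, h5⟩ := h
  cases hs with
  | sourceTuple _ t a outs hS hA =>
    obtain ⟨rfl, -⟩ := hA
    refine ⟨?_, ?_, ?_, ?_, ?_⟩
    · simpa [wmsOf_append, wmsOf_entries, wmsIn_succ_tup hS] using h1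
    · change s.a1.wm = _
      simpa [wmsOf_append, wmsOf_entries] using h2
    · simpa [List.take_append_of_le_length h5] using h3
    · simpa using h4.trans (Nat.le_add_right _ _)
    · simpa using h5.trans (Nat.le_add_right _ _)
  | sourceWatermark _ w hS =>
    refine ⟨?_, h2, h3, h4, h5⟩
    simp only [wmsIn_succ_wm hS, ← h1, List.append_assoc]
  | update _ w ws a outs hw hA =>
    obtain ⟨rfl, -⟩ := hA
    refine ⟨?_, ?_, ?_, ?_, ?_⟩
    · simpa [wmsOf_append, wmsOf_entries, hw] using h1
    · simp only [wmsOf_append, wmsOf_entries, h2, List.append_nil, ← List.append_assoc]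
      rw [List.foldl_append (l' := [w])]
      rfl
    · simpa [List.take_append_of_le_length h5] using h3
    · simpa using h4.trans (Nat.le_add_right _ _)
    · simpa using h5.trans (Nat.le_add_right _ _)
  | loopTuple _ t w a outs ht hA =>
    obtain ⟨rfl, -⟩ := hA
    have := (List.getElem?_eq_some_iff.1 ht).1
    refine ⟨?_, ?_, ?_, ?_, ?_⟩
    · simpa [wmsOf_append, wmsOf_entries] using h1
    · change s.a1.wm = _
      simpa [wmsOf_append, wmsOf_entries] using h2
    · simpa [List.take_append_of_le_length h5] using h3
    · simp only [List.length_append]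
      omega
    · simpa using h5.trans (Nat.le_add_right _ _)
  | loopWatermark _ w hw => exact ⟨h1, h2, h3, (List.getElem?_eq_some_iff.1 hw).1, h5⟩
  | forward _ w ws hw =>
    refine ⟨?_, ?_, ?_, ?_, ?_⟩
    · simpa [wmsOf_append, wmsOf_wm, hw] using h1
    · simpa [wmsOf_append, wmsOf_wm, hw] using h2
    · simpa [List.take_append_of_le_length h5] using h3
    · simpa using h4.trans (Nat.le_add_right _ _)
    · simpa using h5.trans (Nat.le_add_right _ _)
  | deliverTuple _ t w a outs ht hA =>
    obtain ⟨rfl, -⟩ := hA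
    refine ⟨h1, h2, ?_, h4, (List.getElem?_eq_some_iff.1 ht).1⟩
    change s.a2.wm = _
    simpa [take_succ_of_getElem? ht, wmsOf_append, show wmsOf [Item.tup (t, w)] = [] from rfl]
      using h3
  | deliverWatermark _ w a outs hw hA =>
    obtain ⟨rfl, -⟩ := hA
    refine ⟨h1, h2, ?_, h4, (List.getElem?_eq_some_iff.1 hw).1⟩
    simp only [take_succ_of_getElem? hw, wmsOf_append, wmsOf_wm, List.foldl_append, ← h3,
      List.foldl_cons, List.foldl_nil]

theorem Bookkeeping.count_eq_mult (h : Bookkeeping S s) (hW : WatermarksSound S) (hδ : 0 < δ)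
    {k : ETup α} (hk : k.τ + δ ≤ s.a1.wm) : (recv S s.pos).count k = mult S k := by
  rw [h.wm1] at hk
  obtain ⟨w, hw, hkw⟩ := exists_le_of_le_foldl_max (by omega) hk
  exact hW.count_recv_eq_mult (h.used_subset hw) (by omega)

/-! ### The loop -/

/-- What the first Aggregate stores and what its output stream contains. -/
structure LoopInv (u : UnionReading) (δ L : ℕ) (S : ℕ → Item (ETup α)) (s : State α) : Prop where
  stored : Stores δ s.a1 (recv S s.pos ++ tuplesOf (s.sA2.take s.rd1))
  /-- the annotation is the first watermark that closes the window -/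
  annot : ∀ t v, Item.tup (t, v) ∈ s.sA2 → v ∈ wmsOf s.sA2 ++ s.fwd ∧ t.τ + δ ≤ v ∧
    ∀ w ∈ wmsIn S s.pos, t.τ + δ ≤ w → v ≤ w
  /-- no tuple in the loop comes too late -/
  accepted : ∀ t v, Item.tup (t, v) ∈ s.sA2.drop s.rd1 → s.a1.wm < t.τ + δ + L
  /-- the output consists of links of chains that start in closed windows -/
  chain : ∀ x ∈ tuplesOf s.sA2, ∃ k ∈ recv S s.pos, k.τ + δ ≤ s.a1.wm ∧
    ∃ i ≤ (embedded S u k).length, x = link S u k i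
  /-- every closed window of an input tuple has been output -/
  root : ∀ k ∈ recv S s.pos, k.τ + δ ≤ s.a1.wm → link S u k 0 ∈ tuplesOf s.sA2
  next_mem : ∀ y ∈ tuplesOf (s.sA2.take s.rd1), ∀ x, next y = some x → x ∈ tuplesOf s.sA2
  prev_mem : ∀ x ∈ tuplesOf s.sA2, x.val.2 = 0 ∨
    ∃ y ∈ tuplesOf (s.sA2.take s.rd1), next y = some x
  nodup : (tuplesOf s.sA2).Nodup

theorem loopInv_init : LoopInv u δ L S (State.init α) := by
  constructor
  case stored => exact stores_init
  all_goals simp [State.init, tuplesOf, recv]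

theorem LoopInv.facts (h : LoopInv u δ L S s) (hE : IsEmbedStream δ S) {x : ETup α}
    (hx : x ∈ tuplesOf s.sA2) : δ ∣ x.τ ∧ x.τ + δ ≤ s.a1.wm ∧ 0 ≤ x.val.2 := by
  obtain ⟨k, hk, hwm, i, -, rfl⟩ := h.chain x hx
  obtain ⟨j, -, hj⟩ := mem_recv.1 hk
  exact ⟨(hE j k hj).1, hwm, by simp [link]⟩

theorem LoopInv.dvd (h : LoopInv u δ L S s) (hE : IsEmbedStream δ S) :
    ∀ t ∈ recv S s.pos ++ tuplesOf (s.sA2.take s.rd1), δ ∣ t.τ := by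
  intro t ht
  rcases List.mem_append.1 ht with ht | ht
  · obtain ⟨j, -, hj⟩ := mem_recv.1 ht
    exact (hE j t hj).1
  · exact (h.facts hE (mem_of_take ht)).1

/-- A tuple of the input stream causes no output: it is never late. -/
theorem LoopInv.source_outputs (h : LoopInv u δ L S s) (hB : Bookkeeping S s)
    (hE : IsEmbedStream δ S) (hW : WatermarksSound S) (hδ : 0 < δ) {t : ETup α}
    (hS : S s.pos = .tup t) {b : AggState (EVal α) (ETup α)} {outs : List (ETup α)}
    (hA : (A₁ u δ L).OnTuple δ s.a1 t b outs) :
    b.wm = s.a1.wm ∧ Stores δ b (recv S s.pos ++ tuplesOf (s.sA2.take s.rd1) ++ [t]) ∧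
      outs = [] := by
  have hle := hB.wm1_le_τ hW hS
  obtain ⟨h1, h2, h3⟩ := (isTumbling_A₁ u δ L).onTuple hδ h.stored (hE _ t hS).1
    (by omega) hA
  exact ⟨h1, h2, by rw [h3, if_neg (by omega)]⟩

/-- A looping tuple is late, so that the first Aggregate outputs its successor at once. -/
theorem LoopInv.loop_outputs (h : LoopInv u δ L S s) (hE : IsEmbedStream δ S) (hδ : 0 < δ)
    {t : ETup α} {w : ℕ} (ht : s.sA2[s.rd1]? = some (.tup (t, w)))
    {b : AggState (EVal α) (ETup α)} {outs : List (ETup α)}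
    (hA : (A₁ u δ L).OnTuple δ s.a1 t b outs) :
    b.wm = s.a1.wm ∧ Stores δ b (recv S s.pos ++ tuplesOf (s.sA2.take s.rd1) ++ [t]) ∧
      outs = (next t).toList := by
  obtain ⟨hdvd, hle, hpos⟩ := h.facts hE (mem_tuplesOf.2 ⟨w, List.mem_of_getElem? ht⟩)
  have hacc := h.accepted t w (by rw [drop_of_getElem? ht]; exact List.mem_cons_self)
  obtain ⟨h1, h2, h3⟩ := (isTumbling_A₁ u δ L).onTuple hδ h.stored hdvd hacc hA
  exact ⟨h1, h2, by rw [h3, if_pos hle, copiesResult_A₁_loop (by omega) (Nat.succ_pos _)]⟩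

/-- A watermark update outputs one tuple with index `0` for each input tuple whose window is newly
reached. -/
theorem LoopInv.update_outputs (h : LoopInv u δ L S s) (hB : Bookkeeping S s)
    (hE : IsEmbedStream δ S) (hW : WatermarksSound S) (hδ : 0 < δ) {w : ℕ} {ws : List ℕ}
    (hw : s.pend = w :: ws) {b : AggState (EVal α) (ETup α)} {outs : List (ETup α)}
    (hA : (A₁ u δ L).OnWatermark δ s.a1 w b outs) :
    b.wm = w ∧ Stores δ b (recv S s.pos ++ tuplesOf (s.sA2.take s.rd1)) ∧ outs.Nodup ∧
      ∀ x, x ∈ outs ↔ ∃ k ∈ recv S s.pos, (s.a1.wm < k.τ + δ ∧ k.τ + δ ≤ w) ∧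
        x = link S u k 0 := by
  obtain ⟨h1, h2, h3⟩ := (isTumbling_A₁ u δ L).onWatermark h.stored (h.dvd hE) hA
  have hmax : max s.a1.wm w = w := max_eq_right (hB.wm1_le_pend hW hw)
  rw [hmax] at h1 h3
  set l := recv S s.pos ++ tuplesOf (s.sA2.take s.rd1) with hl
  set K := l.dedup.filter fun k => s.a1.wm < k.τ + δ ∧ k.τ + δ ≤ w with hK
  have hwin : w ∈ wmsIn S s.pos := by simp [← hB.wms, hw]
  have hKmem : ∀ k, k ∈ K ↔ k ∈ recv S s.pos ∧ s.a1.wm < k.τ + δ ∧ k.τ + δ ≤ w := by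
    intro k
    simp only [hK, hl, List.mem_filter, List.mem_dedup, List.mem_append, decide_eq_true_eq]
    constructor
    · rintro ⟨hk | hk, hc⟩
      · exact ⟨hk, hc⟩
      · have := (h.facts hE (mem_of_take hk)).2.1
        omega
    · exact fun ⟨hk, hc⟩ => ⟨Or.inl hk, hc⟩
  have hmult : ∀ k ∈ K, (recv S s.pos).count k = mult S k := fun k hk =>
    hW.count_recv_eq_mult hwin (by have := ((hKmem k).1 hk).2; omega)
  have hmap : K.filterMap (fun k => (A₁ u δ L).copiesResult k (l.count k)) =
      K.map fun k => link S u k 0 := by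
    rw [← List.filterMap_eq_map]
    refine List.filterMap_congr fun k hk => ?_
    obtain ⟨hkr, hlt, -⟩ := (hKmem k).1 hk
    obtain ⟨j, -, hj⟩ := mem_recv.1 hkr
    have hnot : k ∉ tuplesOf (s.sA2.take s.rd1) := fun hc => by
      have := (h.facts hE (mem_of_take hc)).2.1
      omega
    have hc : l.count k = mult S k := by
      rw [hl, List.count_append, List.count_eq_zero.2 hnot, hmult k hk, add_zero]
    rw [hc, copiesResult_A₁_input (hE j k hj).2.2 (mult_pos_of_count hkr (hmult k hk))]
    rfl
  rw [hmap] at h3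
  refine ⟨h1, h2, ?_, fun x => ?_⟩
  · rw [h3.nodup_iff]
    refine List.Nodup.map_on (fun k hk k' hk' he => ?_) ((List.nodup_dedup l).filter _)
    have hr := ((hKmem k).1 hk).1
    have hr' := ((hKmem k').1 hk').1
    exact (link_inj hE hr hr' (mult_pos_of_count hr (hmult k hk))
      (mult_pos_of_count hr' (hmult k' hk')) he).1
  · rw [h3.mem_iff, List.mem_map]
    simp only [hKmem, and_assoc, eq_comm (a := x)]

theorem LoopInv.step (h : LoopInv u δ L S s) (hB : Bookkeeping S s) (hDL : D ≤ L) (hδ : 0 < δ)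
    (hE : IsEmbedStream δ S) (hW : WatermarksSound S) (hC1 : C1 S D) (hs : Step u δ L S a s s')
    (hC2 : a = .update → ∀ w ws, s.pend = w :: ws → LoopSafe u δ L s w) :
    LoopInv u δ L S s' := by
  have hrd := hB.rd1_le
  cases hs with
  | sourceTuple _ t b outs hS hA =>
    obtain ⟨hwm, hst, rfl⟩ := h.source_outputs hB hE hW hδ hS hA
    have hle := hB.wm1_le_τ hW hS
    have hnil : s.sA2 ++ entries ([] : List (ETup α)) s.a1.wm = s.sA2 := by simp [entries]
    obtain ⟨-, p2, p3, p4, p5, p6, p7, p8⟩ := h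
    constructor <;> simp only [hnil, recv_succ_tup hS, wmsIn_succ_tup hS, hwm] <;> try assumption
    · refine hst.perm ?_
      rw [List.append_assoc, List.append_assoc]
      exact List.perm_append_comm.append_left _
    · intro x hx
      obtain ⟨k, hk, hr⟩ := p4 x hx
      exact ⟨k, List.mem_append_left _ hk, hr⟩
    · intro k hk hkw
      rcases List.mem_append.1 hk with hk | hk
      · exact p5 k hk hkw
      · rw [List.mem_singleton.1 hk] at hkw
        omega
  | sourceWatermark _ w hS =>
    obtain ⟨p1, p2, p3, p4, p5, p6, p7, p8⟩ := h
    constructor <;> simp only [recv_succ_wm hS, wmsIn_succ_wm hS] <;> try assumption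
    intro t v ht
    obtain ⟨h1, h2, h3⟩ := p2 t v ht
    refine ⟨h1, h2, fun w' hw' hle => ?_⟩
    rcases List.mem_append.1 hw' with hw' | hw'
    · exact h3 w' hw' hle
    · rw [List.mem_singleton.1 hw']
      exact hW.le_wm (hB.used_subset h1) le_rfl hS
  | update _ w ws b outs hw hA =>
    obtain ⟨hwm, hst, hnd, hout⟩ := h.update_outputs hB hE hW hδ hw hA
    have hle := hB.wm1_le_pend hW hw
    have hsafe := hC2 rfl w ws hw
    have hfacts := fun x hx => h.facts hE (x := x) hx
    obtain ⟨-, p2, p3, p4, p5, p6, p7, p8⟩ := h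
    constructor <;> simp only [hwm, wmsOf_append, tuplesOf_append, wmsOf_entries, tuplesOf_entries,
      List.take_append_of_le_length hrd, List.drop_append_of_le_length hrd, List.append_nil]
    · exact hst
    · intro t v ht
      rcases List.mem_append.1 ht with ht | ht
      · obtain ⟨h1, h2, h3⟩ := p2 t v ht
        refine ⟨?_, h2, h3⟩
        rw [← List.append_assoc]
        exact List.mem_append_left _ h1
      · obtain ⟨hto, rfl⟩ := mem_entries.1 ht
        obtain ⟨k, hk, ⟨hlt, hkw⟩, rfl⟩ := (hout t).1 hto
        refine ⟨by simp, hkw, fun w' hw' hle' => ?_⟩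
        change k.τ + δ ≤ w' at hle'
        have hsort := hW.pairwise s.pos
        rw [← hB.wms] at hw' hsort
        rcases List.mem_append.1 hw' with hm | hm
        · have := le_foldl_max hm
          rw [← hB.wm1] at this
          omega
        · rw [hw] at hm hsort
          rcases List.mem_cons.1 hm with rfl | hm
          · exact le_rfl
          · exact (List.pairwise_cons.1 (List.pairwise_append.1 hsort).2.1).1 _ hm
    · intro t v ht
      rcases List.mem_append.1 ht with ht | ht
      · have hd := (hfacts t (mem_tuplesOf.2 ⟨v, List.mem_of_mem_drop ht⟩)).1
        have := hsafe t v ht (t.τ / δ) (((isTumbling_A₁ u δ L).falls_iff hδ).2 rfl)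
        rwa [Agg.Accepts, (isTumbling_A₁ u δ L).right, Nat.div_mul_cancel hd] at this
      · obtain ⟨k, hk, ⟨hlt, hkw⟩, rfl⟩ := (hout t).1 (mem_entries.1 ht).1
        have := hB.pend_lt hW hC1 hδ hk hw hlt hkw
        change w < k.τ + δ + L
        omega
    · intro x hx
      rcases List.mem_append.1 hx with hx | hx
      · obtain ⟨k, hk, hkw, hr⟩ := p4 x hx
        exact ⟨k, hk, hkw.trans hle, hr⟩
      · obtain ⟨k, hk, ⟨hlt, hkw⟩, rfl⟩ := (hout x).1 hx
        exact ⟨k, hk, hkw, 0, Nat.zero_le _, rfl⟩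
    · intro k hk hkw
      rcases lt_or_ge s.a1.wm (k.τ + δ) with hlt | hge
      · exact List.mem_append_right _ ((hout _).2 ⟨k, hk, ⟨hlt, hkw⟩, rfl⟩)
      · exact List.mem_append_left _ (p5 k hk hge)
    · exact fun y hy x hx => List.mem_append_left _ (p6 y hy x hx)
    · intro x hx
      rcases List.mem_append.1 hx with hx | hx
      · exact p7 x hx
      · obtain ⟨k, hk, -, rfl⟩ := (hout x).1 hx
        exact Or.inl rfl
    · refine List.nodup_append.2 ⟨p8, hnd, ?_⟩
      rintro x hx _ hx' rfl
      obtain ⟨k, hk, ⟨hlt, hkw⟩, rfl⟩ := (hout x).1 hx'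
      have : k.τ + δ ≤ s.a1.wm := (hfacts _ hx).2.1
      omega
  | loopTuple _ t w b outs ht hA =>
    obtain ⟨hwm, hst, rfl⟩ := h.loop_outputs hE hδ ht hA
    have hrd' : s.rd1 + 1 ≤ s.sA2.length := (List.getElem?_eq_some_iff.1 ht).1
    have htl : t ∈ tuplesOf s.sA2 := mem_tuplesOf.2 ⟨w, List.mem_of_getElem? ht⟩
    have hdrop := drop_of_getElem? ht
    have htake : tuplesOf (s.sA2.take (s.rd1 + 1)) = tuplesOf (s.sA2.take s.rd1) ++ [t] := by
      rw [take_succ_of_getElem? ht, tuplesOf_append]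
      rfl
    have hnew : t ∉ tuplesOf (s.sA2.take s.rd1) := by
      have := h.nodup
      rw [← List.take_append_drop (s.rd1 + 1) s.sA2, tuplesOf_append, htake] at this
      have := (List.nodup_append.1 this).1
      exact fun hc => (List.nodup_append.1 this).2.2 t hc t (by simp) rfl
    have hnext : ∀ x, x ∈ (next t).toList ↔ next t = some x := fun x => Option.mem_toList
    have hfacts := h.facts hE htl
    obtain ⟨-, p2, p3, p4, p5, p6, p7, p8⟩ := h
    constructor <;> simp only [hwm, wmsOf_append, tuplesOf_append, wmsOf_entries, tuplesOf_entries,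
      List.take_append_of_le_length hrd', List.drop_append_of_le_length hrd', List.append_nil,
      htake]
    · rwa [← List.append_assoc]
    · intro t' v ht'
      rcases List.mem_append.1 ht' with ht' | ht'
      · exact p2 t' v ht'
      · obtain ⟨hto, rfl⟩ := mem_entries.1 ht'
        obtain ⟨-, rfl⟩ := next_eq_some ((hnext t').1 hto)
        exact p2 t _ (List.mem_of_getElem? ht)
    · intro t' v ht'
      rcases List.mem_append.1 ht' with ht' | ht'
      · exact p3 t' v (by rw [hdrop]; exact List.mem_cons_of_mem _ ht')
      · obtain ⟨hto, rfl⟩ := mem_entries.1 ht'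
        obtain ⟨-, rfl⟩ := next_eq_some ((hnext t').1 hto)
        exact p3 t _ (by rw [hdrop]; exact List.mem_cons_self)
    · intro x hx
      rcases List.mem_append.1 hx with hx | hx
      · exact p4 x hx
      · obtain ⟨hlt, rfl⟩ := next_eq_some ((hnext x).1 hx)
        obtain ⟨k, hk, hkw, i, hi, rfl⟩ := p4 t htl
        simp only [link, Nat.cast_lt] at hlt
        exact ⟨k, hk, hkw, i + 1, hlt, by simp [link]⟩
    · exact fun k hk hkw => List.mem_append_left _ (p5 k hk hkw)
    · intro y hy x hx
      rcases List.mem_append.1 hy with hy | hy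
      · exact List.mem_append_left _ (p6 y hy x hx)
      · rw [List.mem_singleton.1 hy] at hx
        exact List.mem_append_right _ ((hnext x).2 hx)
    · intro x hx
      rcases List.mem_append.1 hx with hx | hx
      · rcases p7 x hx with h0 | ⟨y, hy, hyx⟩
        · exact Or.inl h0
        · exact Or.inr ⟨y, List.mem_append_left _ hy, hyx⟩
      · exact Or.inr ⟨t, by simp, (hnext x).1 hx⟩
    · refine List.nodup_append.2 ⟨p8, ?_, ?_⟩
      · cases next t <;> simp
      · rintro x hx _ hx' rfl
        have hx' := (hnext x).1 hx'
        -- the predecessor of `x` in the loop is unique and has not been read before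
        rcases p7 x hx with h0 | ⟨y, hy, hyx⟩
        · obtain ⟨-, rfl⟩ := next_eq_some hx'
          change t.val.2 + 1 = 0 at h0
          omega
        · exact hnew (next_inj hyx hx' ▸ hy)
  | loopWatermark _ w hw =>
    have htake : tuplesOf (s.sA2.take (s.rd1 + 1)) = tuplesOf (s.sA2.take s.rd1) := by
      rw [take_succ_of_getElem? hw, tuplesOf_append]
      exact List.append_nil _
    have hdrop := drop_of_getElem? hw
    obtain ⟨p1, p2, p3, p4, p5, p6, p7, p8⟩ := h
    constructor <;> simp only [htake] <;> try assumption
    intro t v ht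
    exact p3 t v (by rw [hdrop]; exact List.mem_cons_of_mem _ ht)
  | forward _ w ws hw =>
    have hnil : tuplesOf ([.wm w] : List (Item (ETup α × ℕ))) = [] := rfl
    obtain ⟨p1, p2, p3, p4, p5, p6, p7, p8⟩ := h
    constructor <;> simp only [tuplesOf_append, wmsOf_append, hnil, wmsOf_wm,
      List.take_append_of_le_length hrd, List.drop_append_of_le_length hrd,
      List.append_nil] <;> try assumption
    · intro t v ht
      have := p2 t v (by simpa using ht)
      simpa [hw] using this
    · exact fun t v ht => p3 t v (by simpa using ht)
  | deliverTuple _ t w b outs ht hA =>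
    obtain ⟨p1, p2, p3, p4, p5, p6, p7, p8⟩ := h
    constructor <;> assumption
  | deliverWatermark _ w b outs hw hA =>
    obtain ⟨p1, p2, p3, p4, p5, p6, p7, p8⟩ := h
    constructor <;> assumption

end Invariants

/-! ### The output of the second Aggregate -/

theorem countP_eq_add {β : Type*} {p q r : β → Prop} [DecidablePred p] [DecidablePred q]
    [DecidablePred r] (l : List β) (hp : ∀ a ∈ l, p a ↔ q a ∨ r a)
    (hqr : ∀ a ∈ l, ¬ (q a ∧ r a)) :
    l.countP (p ·) = l.countP (q ·) + l.countP (r ·) := by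
  induction l with
  | nil => rfl
  | cons a l ih =>
    simp only [List.forall_mem_cons] at hp hqr
    simp only [List.countP_cons, ih hp.2 hqr.2, decide_eq_true_eq]
    by_cases hq : q a <;> by_cases hr : r a <;> simp_all <;> omega

section Output

variable {α : Type*} [DecidableEq α] {u : UnionReading} {δ L : ℕ} {S : ℕ → Item (ETup α)}
  {s s' : State α} {a : Act}

/-- What the second Aggregate stores and has output. -/
structure OutputInv (δ : ℕ) (s : State α) : Prop where
  stored : Stores δ s.a2 (tuplesOf (s.sA2.take s.rd2))
  count : ∀ x, s.sO.count (.tup x) = (tuplesOf (s.sA2.take s.rd2)).countP fun t =>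
    extract t = some x ∧ t.τ + δ ≤ s.a2.wm

theorem outputInv_init : OutputInv δ (State.init α) := by
  constructor
  case stored => exact stores_init
  case count => simp [State.init, tuplesOf]

/-- Each tuple reaches the second Aggregate before the first watermark that closes its window:
otherwise this watermark, which is the annotation of the tuple, has been forwarded too early. -/
theorem LoopInv.wm2_lt (h : LoopInv u δ L S s) (hB : Bookkeeping S s) (hδ : 0 < δ)
    (hW : WatermarksSound S)
    (hC3 : ∀ (i j w : ℕ) (t : ETup α), s.sA2[i]? = some (.wm w) →
      s.sA2[j]? = some (.tup (t, w)) → j < i)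
    {t : ETup α} {v : ℕ} (ht : s.sA2[s.rd2]? = some (.tup (t, v))) : s.a2.wm < t.τ + δ := by
  by_contra! hle
  rw [hB.wm2] at hle
  obtain ⟨w, hw, htw⟩ := exists_le_of_le_foldl_max (by omega) hle
  obtain ⟨hv, -, hfirst⟩ := h.annot t v (List.mem_of_getElem? ht)
  have hsplit : wmsOf s.sA2 = wmsOf (s.sA2.take s.rd2) ++ wmsOf (s.sA2.drop s.rd2) := by
    rw [← wmsOf_append, List.take_append_drop]
  have hvw : v ≤ w := by
    refine hfirst w (hB.used_subset ?_) htw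
    rw [hsplit]
    simp [hw]
  have hvmem : v ∈ wmsOf (s.sA2.take s.rd2) := by
    rw [hsplit, List.append_assoc] at hv
    rcases List.mem_append.1 hv with hv | hv
    · exact hv
    · have hsort := hW.pairwise s.pos
      rw [← hB.wms, hsplit, List.append_assoc, List.append_assoc, List.pairwise_append] at hsort
      have := hsort.2.2 w hw v (by rw [← List.append_assoc]; exact List.mem_append_left _ hv)
      rwa [le_antisymm hvw this]
  obtain ⟨i, hi⟩ := List.mem_iff_getElem?.1 (mem_wmsOf.1 hvmem)
  rw [List.getElem?_take] at hi
  split_ifs at hi with hlt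
  have := hC3 i s.rd2 v t hi ht
  omega

theorem OutputInv.step (h : OutputInv δ s) (hL : LoopInv u δ L S s) (hB : Bookkeeping S s)
    (hδ : 0 < δ) (hE : IsEmbedStream δ S) (hW : WatermarksSound S)
    (hC3 : ∀ (i j w : ℕ) (t : ETup α), s.sA2[i]? = some (.wm w) →
      s.sA2[j]? = some (.tup (t, w)) → j < i)
    (hs : Step u δ L S a s s') : OutputInv δ s' := by
  have hrd := hB.rd2_le
  obtain ⟨h1, h2⟩ := h
  cases hs with
  | sourceTuple | update | loopTuple | forward =>
    constructor <;> simpa only [List.take_append_of_le_length hrd]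
  | sourceWatermark | loopWatermark => exact ⟨h1, h2⟩
  | deliverTuple _ t w b outs ht hA =>
    have hlt := hL.wm2_lt hB hδ hW hC3 ht
    have hdvd := (hL.facts hE (mem_tuplesOf.2 ⟨w, List.mem_of_getElem? ht⟩)).1
    obtain ⟨hwm, hst, rfl⟩ := (isTumbling_A₂ δ).onTuple hδ h1 hdvd
      (hlt.trans_le (Nat.le_add_right _ _)) hA
    have htake : tuplesOf (s.sA2.take (s.rd2 + 1)) = tuplesOf (s.sA2.take s.rd2) ++ [t] := by
      rw [take_succ_of_getElem? ht, tuplesOf_append]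
      rfl
    rw [if_neg (by omega)]
    constructor <;> simp only [htake, hwm]
    · exact hst
    · intro x
      simp [h2 x, hlt]
  | deliverWatermark _ w b outs hw hA =>
    have htake : tuplesOf (s.sA2.take (s.rd2 + 1)) = tuplesOf (s.sA2.take s.rd2) := by
      rw [take_succ_of_getElem? hw, tuplesOf_append]
      exact List.append_nil _
    have hnd : (tuplesOf (s.sA2.take s.rd2)).Nodup :=
      hL.nodup.sublist ((List.take_sublist _ _).filterMap _)
    obtain ⟨hwm, hst, hout⟩ := (isTumbling_A₂ δ).onWatermark h1
      (fun t ht => (hL.facts hE (mem_of_take ht)).1) hA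
    constructor <;> simp only [htake, hwm]
    · exact hst
    · intro x
      set l := tuplesOf (s.sA2.take s.rd2) with hl
      have hx : outs.count x = l.countP fun t =>
          extract t = some x ∧ s.a2.wm < t.τ + δ ∧ t.τ + δ ≤ max s.a2.wm w := by
        have hmap : (l.filter fun k => s.a2.wm < k.τ + δ ∧ k.τ + δ ≤ max s.a2.wm w).filterMap
            (fun k => (A₂ δ).copiesResult k (l.count k)) =
            (l.filter fun k => s.a2.wm < k.τ + δ ∧ k.τ + δ ≤ max s.a2.wm w).filterMap extract :=
          List.filterMap_congr fun k hk =>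
            copiesResult_A₂ (List.count_pos_iff.2 (List.mem_of_mem_filter hk))
        rw [hout.count_eq, hnd.dedup, hmap, List.count_filterMap, List.countP_filter]
        refine List.countP_congr fun t _ => ?_
        simp
      have hinj : Function.Injective (Item.tup : Tup α → Item (Tup α)) :=
        fun a b hab => Item.tup.inj hab
      have hadd : (l.countP fun t => extract t = some x ∧ t.τ + δ ≤ max s.a2.wm w) =
          (l.countP fun t => extract t = some x ∧ t.τ + δ ≤ s.a2.wm) +
          l.countP fun t =>
            extract t = some x ∧ s.a2.wm < t.τ + δ ∧ t.τ + δ ≤ max s.a2.wm w := by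
        refine countP_eq_add l (fun t _ => ?_) ?_
        · rw [← and_or_left]
          refine and_congr_right fun _ => ?_
          omega
        · rintro t - ⟨⟨-, h⟩, -, h', -⟩
          omega
      rw [List.count_append, List.count_append, List.count_map_of_injective _ _ hinj, hx, h2 x,
        hadd]
      simp

end Output

/-! ### Progress -/

/-- The amount of processing that a looping tuple still needs. -/
def weight {α : Type*} (t : ETup α) : ℕ := ((t.val.1.length : ℤ) - t.val.2).toNat + 1

/-- The amount of processing needed by a log entry whose annotation satisfies `P`. -/
def itemWeight {α : Type*} (P : ℕ → Prop) [DecidablePred P] : Item (ETup α × ℕ) → ℕ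
  | .tup (t, v) => if P v then weight t else 0
  | .wm _ => 0

/-- The amount of processing needed by the tuples in the loop whose annotation satisfies `P`. -/
def load {α : Type*} (P : ℕ → Prop) [DecidablePred P] (s : State α) : ℕ :=
  ((s.sA2.drop s.rd1).map (itemWeight P)).sum

theorem weight_next {α : Type*} {t x : ETup α} (h : next t = some x) : weight x < weight t := by
  obtain ⟨hlt, rfl⟩ := next_eq_some h
  simp only [weight]
  omega

section Progress

variable {α : Type*} [DecidableEq α] {u : UnionReading} {δ L : ℕ} {S : ℕ → Item (ETup α)}
  {s s' : State α} {a : Act}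

/-- The watermarks that the first Aggregate has used for an update, in this order. -/
def State.used (s : State α) : List ℕ := wmsOf s.sA2 ++ s.fwd

theorem Step.mono (hs : Step u δ L S a s s') : s.pos ≤ s'.pos ∧ s.rd2 ≤ s'.rd2 ∧
    s.sA2 <+: s'.sA2 ∧ s.used <+: s'.used := by
  cases hs <;> refine ⟨by simp, by simp, by simp, ?_⟩ <;>
    simp_all [State.used, wmsOf_append, wmsOf_entries, wmsOf_wm]

theorem Step.rd1_eq (hs : Step u δ L S a s s') :
    s'.rd1 = s.rd1 ∨ a = .loop ∧ s'.rd1 = s.rd1 + 1 := by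
  cases hs <;> simp

theorem Step.pos_lt (hs : Step u δ L S .source s s') : s.pos < s'.pos := by
  cases hs <;> simp

theorem Step.rd1_lt (hs : Step u δ L S .loop s s') : s.rd1 < s'.rd1 := by
  cases hs <;> simp

theorem Step.rd2_lt (hs : Step u δ L S .deliver s s') : s.rd2 < s'.rd2 := by
  cases hs <;> simp

theorem Step.used_lt (hs : Step u δ L S .update s s') : s.used.length < s'.used.length := by
  cases hs
  simp [State.used, wmsOf_append, wmsOf_entries]

theorem Step.forwarded_lt (hs : Step u δ L S .forward s s') :
    (wmsOf s.sA2).length < (wmsOf s'.sA2).length := by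
  cases hs
  simp [wmsOf_append, wmsOf_wm]

theorem Step.pend_prefix (hs : Step u δ L S a s s') (ha : a ≠ .update) : s.pend <+: s'.pend := by
  cases hs <;> simp_all

theorem Step.fwd_prefix (hs : Step u δ L S a s s') (ha : a ≠ .forward) : s.fwd <+: s'.fwd := by
  cases hs <;> simp_all

/-- The load does not increase, unless an update opens new work, and every looping tuple that is
read decreases it. -/
theorem LoopInv.load_step (h : LoopInv u δ L S s) (hB : Bookkeeping S s)
    (hE : IsEmbedStream δ S) (hW : WatermarksSound S) (hδ : 0 < δ) (P : ℕ → Prop)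
    [DecidablePred P] (hs : Step u δ L S a s s')
    (hup : a = .update → ∀ w ws, s.pend = w :: ws → P w → w ≤ s.a1.wm) :
    load P s' ≤ load P s ∧ (a = .loop → ∀ t v, s.sA2[s.rd1]? = some (.tup (t, v)) → P v →
      load P s' < load P s) := by
  have hrd := hB.rd1_le
  cases hs with
  | sourceTuple _ t b outs hS hA =>
    obtain ⟨-, -, rfl⟩ := h.source_outputs hB hE hW hδ hS hA
    simp [load, entries]
  | update _ w ws b outs hw hA =>
    refine ⟨le_of_eq ?_, fun h => by cases h⟩
    simp only [load, List.drop_append_of_le_length hrd, List.map_append, List.sum_append]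
    refine Nat.add_eq_left.2 (List.sum_eq_zero fun y hy => ?_)
    obtain ⟨z, hz, rfl⟩ := List.mem_map.1 hy
    obtain ⟨x, hx, rfl⟩ := List.mem_map.1 hz
    refine if_neg fun hP => ?_
    obtain ⟨k, -, ⟨h1, h2⟩, -⟩ := ((h.update_outputs hB hE hW hδ hw hA).2.2.2 x).1 hx
    have := hup rfl w ws hw hP
    omega
  | loopTuple _ t w b outs ht hA =>
    obtain ⟨-, -, rfl⟩ := h.loop_outputs hE hδ ht hA
    have hrd' : s.rd1 + 1 ≤ s.sA2.length := (List.getElem?_eq_some_iff.1 ht).1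
    simp only [load, List.drop_append_of_le_length hrd', drop_of_getElem? ht, List.map_append,
      List.sum_append, List.map_cons, List.sum_cons]
    have hnew : ((entries (next t).toList w).map (itemWeight P)).sum ≤ itemWeight P (.tup (t, w)) ∧
        (P w → ((entries (next t).toList w).map (itemWeight P)).sum <
          itemWeight P (.tup (t, w))) := by
      by_cases hP : P w
      · cases hn : next t with
        | none => simp [entries, itemWeight, hP, weight]
        | some x =>
          have := weight_next hn
          simp only [Option.toList, entries, itemWeight, hP, List.map_cons, List.map_nil,
            List.sum_cons, List.sum_nil]
          simp only [if_true]
          omega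
      · cases next t <;> simp [entries, itemWeight, hP]
    refine ⟨by omega, fun _ t' v ht' hv => ?_⟩
    rw [ht] at ht'
    cases ht'
    have := hnew.2 hv
    omega
  | loopWatermark _ w hw =>
    refine ⟨?_, fun _ t v ht => by rw [hw] at ht; cases ht⟩
    simp [load, drop_of_getElem? hw]
  | forward _ w ws hw =>
    simp [load, List.drop_append_of_le_length hrd, itemWeight]
  | sourceWatermark | deliverTuple | deliverWatermark => exact ⟨le_rfl, fun h => by cases h⟩

end Progress

/-- A monotone sequence that grows at some later time whenever it is below `B` reaches `B`. -/
theorem exists_le_of_progress {f : ℕ → ℕ} (hf : Monotone f) (B n : ℕ)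
    (h : ∀ m, n ≤ m → f m < B → ∃ m', m ≤ m' ∧ (B ≤ f m' ∨ f m' < f (m' + 1))) :
    ∃ m, n ≤ m ∧ B ≤ f m := by
  have key : ∀ c ≤ B, ∃ m, n ≤ m ∧ c ≤ f m := by
    intro c
    induction c with
    | zero => exact fun _ => ⟨n, le_rfl, Nat.zero_le _⟩
    | succ c ih =>
      intro hc
      obtain ⟨m, hnm, hm⟩ := ih (Nat.le_of_succ_le hc)
      rcases lt_or_ge (f m) B with hlt | hge
      · obtain ⟨m', hmm', hm' | hm'⟩ := h m hnm hlt
        · exact ⟨m', hnm.trans hmm', hc.trans hm'⟩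
        · exact ⟨m' + 1, by omega, by have := hf hmm'; omega⟩
      · exact ⟨m, hnm, hc.trans hge⟩
  exact key B le_rfl

section FairRun

open Filter

variable {α : Type*} [DecidableEq α] {u : UnionReading} {δ L : ℕ} {S : ℕ → Item (ETup α)}
  {act : ℕ → Act} {run : ℕ → State α}

/-- A fair execution together with its invariants. -/
structure FairRun (u : UnionReading) (δ L : ℕ) (S : ℕ → Item (ETup α)) (act : ℕ → Act)
    (run : ℕ → State α) : Prop where
  pos : 0 < δ
  embed : IsEmbedStream δ S
  sound : WatermarksSound S
  step : ∀ n, Step u δ L S (act n) (run n) (run (n + 1))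
  fair : Fair u δ L act run
  book : ∀ n, Bookkeeping S (run n)
  loop : ∀ n, LoopInv u δ L S (run n)
  out : ∀ n, OutputInv δ (run n)

theorem fairRun_of_isExecution {D : ℕ} (hδ : 0 < δ) (hDL : D ≤ L) (hE : IsEmbedStream δ S)
    (hW : WatermarksSound S) (hC1 : C1 S D) (hrun : IsExecution u δ L S act run)
    (hfair : Fair u δ L act run) (hC2 : C2 u δ L act run) (hC3 : C3 run) :
    FairRun u δ L S act run := by
  obtain ⟨h0, hstep⟩ := hrun
  have hinv : ∀ n, Bookkeeping S (run n) ∧ LoopInv u δ L S (run n) ∧ OutputInv δ (run n) := by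
    intro n
    induction n with
    | zero =>
      rw [h0]
      exact ⟨bookkeeping_init, loopInv_init, outputInv_init⟩
    | succ n ih =>
      obtain ⟨hB, hL, hO⟩ := ih
      exact ⟨hB.step (hstep n),
        hL.step hB hDL hδ hE hW hC1 (hstep n) fun ha w ws hw => hC2 n w ws ha hw,
        hO.step hL hB hδ hE hW (hC3 n) (hstep n)⟩
  exact ⟨hδ, hE, hW, hstep, hfair, fun n => (hinv n).1, fun n => (hinv n).2.1,
    fun n => (hinv n).2.2⟩

namespace FairRun

variable (R : FairRun u δ L S act run)
include R

theorem monotone_pos : Monotone fun n => (run n).pos :=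
  monotone_nat_of_le_succ fun n => (R.step n).mono.1

theorem monotone_rd1 : Monotone fun n => (run n).rd1 :=
  monotone_nat_of_le_succ fun n => by rcases (R.step n).rd1_eq with h | ⟨-, h⟩ <;> omega

theorem monotone_rd2 : Monotone fun n => (run n).rd2 :=
  monotone_nat_of_le_succ fun n => (R.step n).mono.2.1

theorem sA2_prefix {n m : ℕ} (h : n ≤ m) : (run n).sA2 <+: (run m).sA2 := by
  induction m, h using Nat.le_induction with
  | base => exact List.prefix_rfl
  | succ m _ ih => exact ih.trans (R.step m).mono.2.2.1

theorem used_prefix {n m : ℕ} (h : n ≤ m) : (run n).used <+: (run m).used := by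
  induction m, h using Nat.le_induction with
  | base => exact List.prefix_rfl
  | succ m _ ih => exact ih.trans (R.step m).mono.2.2.2

theorem eventually_pos_ge (p : ℕ) : ∀ᶠ n in atTop, p ≤ (run n).pos := by
  obtain ⟨m, -, hm⟩ := exists_le_of_progress R.monotone_pos p 0 fun m _ _ => by
    obtain ⟨m', hmm', h | h⟩ := R.fair .source m
    · exact ⟨m', hmm', Or.inr (h ▸ R.step m').pos_lt⟩
    · exact absurd trivial h
  exact eventually_atTop.2 ⟨m, fun n hn => hm.trans (R.monotone_pos hn)⟩

/-- Every log entry is eventually read by the first Aggregate. -/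
theorem eventually_rd1 (n : ℕ) :
    ∀ᶠ m in atTop, (run n).sA2 <+: (run m).sA2.take (run m).rd1 := by
  obtain ⟨m, hnm, hm⟩ := exists_le_of_progress R.monotone_rd1 (run n).sA2.length n
    fun m hnm _ => by
      obtain ⟨m', hmm', h | h⟩ := R.fair .loop m
      · exact ⟨m', hmm', Or.inr (h ▸ R.step m').rd1_lt⟩
      · exact ⟨m', hmm', Or.inl <|
          (R.sA2_prefix (hnm.trans hmm')).length_le.trans (not_lt.1 h)⟩
  exact eventually_atTop.2 ⟨m, fun k hk => List.prefix_take_iff.2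
    ⟨R.sA2_prefix (hnm.trans hk), hm.trans (R.monotone_rd1 hk)⟩⟩

/-- Every log entry is eventually read by the second Aggregate. -/
theorem eventually_rd2 (n : ℕ) :
    ∀ᶠ m in atTop, (run n).sA2 <+: (run m).sA2.take (run m).rd2 := by
  obtain ⟨m, hnm, hm⟩ := exists_le_of_progress R.monotone_rd2 (run n).sA2.length n
    fun m hnm _ => by
      obtain ⟨m', hmm', h | h⟩ := R.fair .deliver m
      · exact ⟨m', hmm', Or.inr (h ▸ R.step m').rd2_lt⟩
      · exact ⟨m', hmm', Or.inl <|
          (R.sA2_prefix (hnm.trans hmm')).length_le.trans (not_lt.1 h)⟩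
  exact eventually_atTop.2 ⟨m, fun k hk => List.prefix_take_iff.2
    ⟨R.sA2_prefix (hnm.trans hk), hm.trans (R.monotone_rd2 hk)⟩⟩

/-- If updates open no new work for `P` from some time on, then the loop eventually contains no
tuple whose annotation satisfies `P`. -/
theorem drain (P : ℕ → Prop) [DecidablePred P] (n : ℕ)
    (h : ∀ m, n ≤ m → act m = .update → ∀ w ws, (run m).pend = w :: ws → P w →
      w ≤ (run m).a1.wm) :
    ∃ m, n ≤ m ∧ ∀ m', m ≤ m' → ∀ t v, Item.tup (t, v) ∈ (run m').sA2.drop (run m').rd1 →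
      ¬ P v := by
  induction hload : load P (run n) using Nat.strong_induction_on generalizing n with
  | _ c ih =>
  by_cases hno : ∀ m', n ≤ m' → ∀ t v,
      Item.tup (t, v) ∈ (run m').sA2.drop (run m').rd1 → ¬ P v
  · exact ⟨n, le_rfl, hno⟩
  push Not at hno
  obtain ⟨m', hm', t, v, hmem, hP⟩ := hno
  have hstep : ∀ m, n ≤ m → _ := fun m hm => (R.loop m).load_step (R.book m) R.embed R.sound
    R.pos P (R.step m) (h m hm)
  have hanti : ∀ m, n ≤ m → load P (run m) ≤ load P (run n) := by
    intro m hm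
    induction m, hm using Nat.le_induction with
    | base => exact le_rfl
    | succ m hm ih => exact (hstep m hm).1.trans ih
  -- the step that reads the tuple decreases the load
  obtain ⟨i, hi⟩ := List.mem_iff_getElem?.1 hmem
  rw [List.getElem?_drop] at hi
  set j := (run m').rd1 + i with hj
  have hread : ∃ m, j < (run m).rd1 := by
    obtain ⟨m, hm⟩ := (R.eventually_rd1 m').exists
    refine ⟨m, lt_of_lt_of_le (List.getElem?_eq_some_iff.1 hi).1 ?_⟩
    exact (List.prefix_take_iff.1 hm).2
  classical
  have hfind := Nat.find_spec hread
  have hmin := fun k => Nat.find_min (m := k) hread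
  have hlt : m' < Nat.find hread := by
    by_contra! hle
    have : (run _).rd1 ≤ (run _).rd1 := R.monotone_rd1 hle
    omega
  obtain ⟨k, hk⟩ := Nat.exists_eq_add_one_of_ne_zero (Nat.ne_of_gt (Nat.zero_lt_of_lt hlt))
  rw [hk] at hfind hlt
  have hkj := hmin k (by omega)
  have hnk : n ≤ k := by omega
  rcases (R.step k).rd1_eq with he | ⟨ha, he⟩
  · omega
  have hkj' : (run k).rd1 = j := by omega
  have hget : (run k).sA2[(run k).rd1]? = some (.tup (t, v)) := by
    rw [hkj', ← hi]
    exact ((List.prefix_iff_getElem?.1 (R.sA2_prefix (Nat.le_of_lt_succ hlt))) j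
      (List.getElem?_eq_some_iff.1 hi).1).trans (List.getElem?_eq_getElem _).symm
  have hdec := (hstep k hnk).2 ha t v hget hP
  obtain ⟨m, hm, hres⟩ := ih (load P (run (k + 1))) (by have := hanti k hnk; omega) (k + 1)
    (fun m hm => h m (by omega)) rfl
  exact ⟨m, by omega, hres⟩

/-- An update is not blocked forever: without updates the loop becomes empty, so that C2 permits the
next one. -/
theorem exists_update {n : ℕ} (hn : (run n).pend ≠ []) : ∃ m, n ≤ m ∧ act m = .update := by
  by_contra! hno
  have hpend : ∀ m, n ≤ m → (run m).pend ≠ [] := by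
    intro m hm
    induction m, hm using Nat.le_induction with
    | base => exact hn
    | succ m hm ih => exact fun h => ih (List.prefix_nil.1 (h ▸ (R.step m).pend_prefix (hno m hm)))
  obtain ⟨m, hm, hempty⟩ := R.drain (fun _ => True) n fun m hm ha => absurd ha (hno m hm)
  obtain ⟨m', hm', h | h⟩ := R.fair .update m
  · exact hno m' (hm.trans hm') h
  · obtain ⟨w, ws, hw⟩ := List.exists_cons_of_ne_nil (hpend m' (hm.trans hm'))
    exact h ⟨w, ws, hw, fun t v ht => absurd trivial (hempty m' hm' t v ht)⟩

/-- A forwarding is not blocked forever: later updates add no tuples with the annotation of the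
watermark to be forwarded, so that the loop runs out of such tuples. -/
theorem exists_forward {n : ℕ} (hn : (run n).fwd ≠ []) : ∃ m, n ≤ m ∧ act m = .forward := by
  by_contra! hno
  obtain ⟨w, ws, hw⟩ := List.exists_cons_of_ne_nil hn
  have hfwd : ∀ m, n ≤ m → ∃ ws, (run m).fwd = w :: ws := by
    intro m hm
    induction m, hm using Nat.le_induction with
    | base => exact ⟨ws, hw⟩
    | succ m hm ih =>
      obtain ⟨ws, hws⟩ := ih
      obtain ⟨l, hl⟩ := (R.step m).fwd_prefix (hno m hm)
      exact ⟨ws ++ l, by rw [← hl, hws, List.cons_append]⟩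
  -- an update with `w` again opens no new window
  obtain ⟨m, hm, hempty⟩ := R.drain (fun v => v = w) n fun m hm _ w' _ _ hw' => by
    obtain ⟨ws, hws⟩ := hfwd m hm
    rw [hw', (R.book m).wm1]
    exact le_foldl_max (by simp [hws])
  obtain ⟨m', hm', h | h⟩ := R.fair .forward m
  · exact hno m' (hm.trans hm') h
  · obtain ⟨ws, hws⟩ := hfwd m' (hm.trans hm')
    exact h ⟨w, ws, hws, fun t ht => hempty m' hm' t w ht rfl⟩

theorem used_prefix_wmsIn (n : ℕ) : (run n).used <+: wmsIn S (run n).pos :=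
  ⟨_, (R.book n).wms⟩

/-- Every watermark of the input stream is eventually used for an update. -/
theorem eventually_used (p : ℕ) : ∀ᶠ n in atTop, wmsIn S p <+: (run n).used := by
  have hmono : Monotone fun n => (run n).used.length := fun n m h => (R.used_prefix h).length_le
  obtain ⟨n, hn⟩ := eventually_atTop.1 (R.eventually_pos_ge p)
  obtain ⟨m, hnm, hm⟩ := exists_le_of_progress hmono (wmsIn S p).length n fun m hnm hm => by
    obtain ⟨k, hk, ha⟩ := R.exists_update (n := m) fun hnil => hm.not_ge <| by
      have h1 := (R.book m).wms
      rw [hnil, List.append_nil] at h1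
      rw [State.used, h1]
      exact (wmsIn_prefix (hn m hnm)).length_le
    exact ⟨k, hk, Or.inr (ha ▸ R.step k).used_lt⟩
  exact eventually_atTop.2 ⟨m, fun k hk => List.prefix_of_prefix_length_le
    (wmsIn_prefix (hn k (hnm.trans hk))) (R.used_prefix_wmsIn k) (hm.trans (hmono hk))⟩

/-- Every watermark of the input stream is eventually forwarded downstream. -/
theorem exists_forwarded (p : ℕ) : ∃ n, wmsIn S p <+: wmsOf (run n).sA2 := by
  have hmono : Monotone fun n => (wmsOf (run n).sA2).length :=
    fun n m h => ((R.sA2_prefix h).filterMap _).length_le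
  obtain ⟨n, hn⟩ := eventually_atTop.1 (R.eventually_used p)
  obtain ⟨m, hnm, hm⟩ := exists_le_of_progress hmono (wmsIn S p).length n fun m hnm hm => by
    obtain ⟨k, hk, ha⟩ := R.exists_forward (n := m) fun hnil => hm.not_ge <| by
      have h1 := (hn m hnm).length_le
      rwa [State.used, hnil, List.append_nil] at h1
    exact ⟨k, hk, Or.inr (ha ▸ R.step k).forwarded_lt⟩
  exact ⟨m, List.prefix_of_prefix_length_le (hn m hnm) (List.prefix_append _ _) hm⟩

theorem eventually_wm1_ge {w p : ℕ} (hw : w ∈ wmsIn S p) : ∀ᶠ n in atTop, w ≤ (run n).a1.wm := by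
  filter_upwards [R.eventually_used p] with n hn
  rw [(R.book n).wm1]
  exact le_foldl_max (hn.subset hw)

theorem eventually_wm2_ge {w p : ℕ} (hw : w ∈ wmsIn S p) : ∀ᶠ n in atTop, w ≤ (run n).a2.wm := by
  obtain ⟨m, hm⟩ := R.exists_forwarded p
  filter_upwards [R.eventually_rd2 m] with n hn
  rw [(R.book n).wm2]
  exact le_foldl_max ((hn.filterMap _).subset (hm.subset hw))

end FairRun
end FairRun

/-! ### Comparison with Unfold -/

section Compare

open Filter

variable {α : Type*} [DecidableEq α] {u : UnionReading} {δ L : ℕ} {S : ℕ → Item (ETup α)}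
  {act : ℕ → Act} {run : ℕ → State α}

theorem C1.exists_wmsIn_ge {V : Type*} {S : ℕ → Item (Tup V)} {D : ℕ} (hC1 : C1 S D) (b : ℕ) :
    ∃ p, ∃ w ∈ wmsIn S p, b ≤ w := by
  obtain ⟨n, w, hb, hS⟩ := hC1.periodic b
  exact ⟨n + 1, w, mem_wmsIn.2 ⟨n, n.lt_succ_self, hS⟩, hb⟩

theorem NoRepeats.mult_eq_one {V : Type*} {S : ℕ → Item (Tup V)} (h : NoRepeats S) {i : ℕ}
    {k : Tup V} (hk : S i = .tup k) : mult S k = 1 := by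
  have : {i | S i = .tup k} = {i} := Set.ext fun j => ⟨fun hj => h j i k hj hk, fun hj => hj ▸ hk⟩
  rw [mult, this, Set.ncard_singleton]

omit [DecidableEq α] in
theorem unfoldPrefix_eq (S : ℕ → Item (ETup α)) (m : ℕ) :
    unfoldPrefix S m = (recv S m).flatMap unfold := by
  induction m with
  | zero => rfl
  | succ m ih =>
    unfold unfoldPrefix at ih ⊢
    rw [List.range_succ, List.flatMap_append, ih]
    cases hS : S m with
    | tup t => simp [recv_succ_tup hS, hS]
    | wm w => simp [recv_succ_wm hS, hS]

theorem count_unfold (t : ETup α) (x : Tup α) :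
    (unfold t).count x = if t.τ = x.τ then t.val.1.count x.val else 0 := by
  obtain ⟨τ, v⟩ := x
  have hinj : Function.Injective fun o : α => (⟨t.τ, o⟩ : Tup α) := fun a b h => (Tup.mk.inj h).2
  split_ifs with h
  · obtain rfl : t.τ = τ := h
    exact List.count_map_of_injective _ _ hinj v
  · refine List.count_eq_zero.2 fun hmem => h ?_
    obtain ⟨o, -, ho⟩ := List.mem_map.1 hmem
    exact (Tup.mk.inj ho).1

/-- The input tuples with timestamp `τ` among the first `p` items. -/
def roots (S : ℕ → Item (ETup α)) (p τ : ℕ) : Finset (ETup α) :=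
  (recv S p).toFinset.filter fun k => k.τ = τ

theorem mem_roots {p τ : ℕ} {k : ETup α} : k ∈ roots S p τ ↔ k ∈ recv S p ∧ k.τ = τ := by
  simp [roots]

theorem mem_roots_of_mem_recv (hW : WatermarksSound S) {p w : ℕ} (hw : w ∈ wmsIn S p)
    {q : ℕ} {k : ETup α} (hk : k ∈ recv S q) (hkw : k.τ < w) : k ∈ roots S p k.τ := by
  obtain ⟨i, -, hi⟩ := mem_recv.1 hk
  refine mem_roots.2 ⟨mem_recv.2 ⟨i, ?_, hi⟩, rfl⟩
  by_contra! hle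
  have := hW.le_τ hw hle hi
  omega

/-- How often Unfold emits `x`, once the watermark has passed the timestamp of `x`. -/
theorem count_unfoldPrefix (hW : WatermarksSound S) {p w : ℕ} (hw : w ∈ wmsIn S p) {x : Tup α}
    (hx : x.τ < w) {m : ℕ} (hm : p ≤ m) :
    (unfoldPrefix S m).count x =
      ∑ k ∈ roots S p x.τ, mult S k * k.val.1.count x.val := by
  have hroots : (recv S m).toFinset.filter (fun k => k.τ = x.τ) = roots S p x.τ := by
    ext k
    rw [Finset.mem_filter, List.mem_toFinset]
    constructor
    · rintro ⟨hk, hkx⟩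
      rw [← hkx]
      exact mem_roots_of_mem_recv hW hw hk (hkx ▸ hx)
    · intro hk
      obtain ⟨hk, hkx⟩ := mem_roots.1 hk
      obtain ⟨i, hi, hS⟩ := mem_recv.1 hk
      exact ⟨mem_recv.2 ⟨i, hi.trans_le hm, hS⟩, hkx⟩
  have hwm : w ∈ wmsIn S m := (wmsIn_prefix hm).subset hw
  rw [unfoldPrefix_eq, List.count_flatMap, Finset.sum_list_map_count, ← hroots, Finset.sum_filter]
  refine Finset.sum_congr rfl fun k _ => ?_
  rw [Function.comp_apply, count_unfold, smul_eq_mul, mul_ite, mul_zero]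
  split_ifs with hk
  · rw [hW.count_recv_eq_mult hwm (by omega)]
  · rfl

theorem mult_pos_of_mem_recv {D : ℕ} (hW : WatermarksSound S) (hC1 : C1 S D) {p : ℕ}
    {k : ETup α} (hk : k ∈ recv S p) : 0 < mult S k := by
  obtain ⟨q, w, hw, hkw⟩ := hC1.exists_wmsIn_ge (k.τ + 1)
  exact mult_pos_of_count (mem_roots.1 (mem_roots_of_mem_recv hW hw hk hkw)).1
    (hW.count_recv_eq_mult hw hkw)

namespace FairRun

variable (R : FairRun u δ L S act run)
include R

/-- The whole chain of looping tuples that stems from an input tuple is output by the first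
Aggregate. -/
theorem eventually_link {D : ℕ} (hC1 : C1 S D) {p : ℕ} {k : ETup α} (hk : k ∈ recv S p) {i : ℕ}
    (hi : i ≤ (embedded S u k).length) :
    ∀ᶠ n in atTop, link S u k i ∈ tuplesOf (run n).sA2 := by
  induction i with
  | zero =>
    obtain ⟨q, w, hw, hkw⟩ := hC1.exists_wmsIn_ge (k.τ + δ)
    filter_upwards [R.eventually_wm1_ge hw, R.eventually_pos_ge p] with n hn hp
    obtain ⟨j, hj, hS⟩ := mem_recv.1 hk
    exact (R.loop n).root k (mem_recv.2 ⟨j, hj.trans_le hp, hS⟩) (hkw.trans hn)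
  | succ i ih =>
    obtain ⟨m, hm⟩ := (ih (Nat.le_of_succ_le hi)).exists
    filter_upwards [R.eventually_rd1 m] with n hn
    exact (R.loop n).next_mem _ ((hn.filterMap _).subset hm) _ (next_link hi)

theorem eventually_link_delivered {D : ℕ} (hC1 : C1 S D) {p : ℕ} {k : ETup α}
    (hk : k ∈ recv S p) {i : ℕ} (hi : i ≤ (embedded S u k).length) :
    ∀ᶠ n in atTop, link S u k i ∈ tuplesOf ((run n).sA2.take (run n).rd2) := by
  obtain ⟨m, hm⟩ := (R.eventually_link hC1 hk hi).exists
  filter_upwards [R.eventually_rd2 m] with n hn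
  exact (hn.filterMap _).subset hm

theorem exists_mem_unfold {n : ℕ} {x : Tup α} (hx : Item.tup x ∈ (run n).sO) :
    ∃ i t, S i = .tup t ∧ x ∈ unfold t := by
  rw [← List.count_pos_iff, (R.out n).count, List.countP_pos_iff] at hx
  obtain ⟨t, ht, he⟩ := hx
  obtain ⟨k, hk, hkw, i, -, rfl⟩ := (R.loop n).chain t (mem_of_take ht)
  rw [decide_eq_true_eq, extract_link] at he
  obtain ⟨v, hv, rfl⟩ := Option.map_eq_some_iff.1 he.1
  have hpos := mult_pos_of_count hk ((R.book n).count_eq_mult R.sound R.pos hkw)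
  have hvT := (mem_unionPow u hpos).1 (List.mem_of_getElem? hv)
  obtain ⟨j, -, hj⟩ := mem_recv.1 hk
  exact ⟨j, k, hj, List.mem_map_of_mem hvT⟩

theorem exists_mem_sO {D : ℕ} (hC1 : C1 S D) {i : ℕ} {t : ETup α} (hS : S i = .tup t)
    {x : Tup α} (hx : x ∈ unfold t) : ∃ n, Item.tup x ∈ (run n).sO := by
  obtain ⟨v, hv, rfl⟩ := List.mem_map.1 hx
  have hk : t ∈ recv S (i + 1) := mem_recv.2 ⟨i, i.lt_succ_self, hS⟩
  obtain ⟨j, hj⟩ := List.mem_iff_getElem?.1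
    ((mem_unionPow u (mult_pos_of_mem_recv R.sound hC1 hk)).2 hv)
  change (embedded S u t)[j]? = some v at hj
  obtain ⟨q, w, hw, htw⟩ := hC1.exists_wmsIn_ge (t.τ + δ)
  obtain ⟨n, h1, h2⟩ := ((R.eventually_link_delivered hC1 hk
    (List.getElem?_eq_some_iff.1 hj).1.le).and (R.eventually_wm2_ge hw)).exists
  refine ⟨n, ?_⟩
  rw [← List.count_pos_iff, (R.out n).count, List.countP_pos_iff]
  refine ⟨_, h1, decide_eq_true ⟨?_, htw.trans h2⟩⟩
  rw [extract_link, hj]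
  rfl

/-- How often the second Aggregate eventually has output `x`. -/
theorem eventually_count_sO {D : ℕ} (hC1 : C1 S D) (x : Tup α) {p w : ℕ} (hw : w ∈ wmsIn S p)
    (hx : x.τ + δ ≤ w) :
    ∀ᶠ n in atTop, (run n).sO.count (.tup x) =
      ∑ k ∈ roots S p x.τ, (embedded S u k).count x.val := by
  have hall : ∀ᶠ n in atTop, ∀ k ∈ roots S p x.τ, ∀ i ∈ Finset.range (embedded S u k).length,
      link S u k i ∈ tuplesOf ((run n).sA2.take (run n).rd2) := by
    refine (eventually_all_finset _).2 fun k hk => (eventually_all_finset _).2 fun i hi => ?_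
    exact R.eventually_link_delivered hC1 (mem_roots.1 hk).1 (Finset.mem_range.1 hi).le
  filter_upwards [hall, R.eventually_wm2_ge hw] with n hn hwm
  set l := tuplesOf ((run n).sA2.take (run n).rd2) with hl
  have hnd : l.Nodup := (R.loop n).nodup.sublist ((List.take_sublist _ _).filterMap _)
  have hpos := R.pos
  have hmult : ∀ k ∈ roots S p x.τ, 0 < mult S k := fun k hk =>
    mult_pos_of_mem_recv R.sound hC1 (mem_roots.1 hk).1
  have hset : (l.filter fun t => extract t = some x ∧ t.τ + δ ≤ (run n).a2.wm).toFinset =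
      (roots S p x.τ).biUnion fun k => ((Finset.range (embedded S u k).length).filter
        fun i => (embedded S u k)[i]? = some x.val).image (link S u k) := by
    ext t
    simp only [List.mem_toFinset, List.mem_filter, decide_eq_true_eq, Finset.mem_biUnion,
      Finset.mem_image, Finset.mem_filter, Finset.mem_range]
    constructor
    · rintro ⟨ht, he, -⟩
      obtain ⟨k, hk, -, i, -, rfl⟩ := (R.loop n).chain t (mem_of_take ht)
      have hτ : (link S u k i).τ = x.τ := extract_τ he
      change k.τ = x.τ at hτ
      rw [extract_link] at he
      obtain ⟨v, hv, rfl⟩ := Option.map_eq_some_iff.1 he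
      exact ⟨k, mem_roots_of_mem_recv R.sound hw hk (by simp only at hx; omega), i,
        ⟨(List.getElem?_eq_some_iff.1 hv).1, hv⟩, rfl⟩
    · rintro ⟨k, hk, i, ⟨hi, hv⟩, rfl⟩
      have hτ := (mem_roots.1 hk).2
      refine ⟨hn k hk i (Finset.mem_range.2 hi), ?_, ?_⟩
      · rw [extract_link, hv, hτ]
        rfl
      · change k.τ + δ ≤ _
        omega
  rw [(R.out n).count, List.countP_eq_length_filter, ← List.toFinset_card_of_nodup (hnd.filter _),
    hset, Finset.card_biUnion]
  · refine Finset.sum_congr rfl fun k hk => ?_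
    have hk' := (mem_roots.1 hk).1
    rw [count_eq_card_range, Finset.card_image_of_injective]
    exact fun i j h => (link_inj R.embed hk' hk' (hmult k hk) (hmult k hk) h).2
  · intro k hk k' hk' hne
    refine Finset.disjoint_left.2 ?_
    rintro t ht ht'
    obtain ⟨i, -, rfl⟩ := Finset.mem_image.1 ht
    obtain ⟨j, -, hj⟩ := Finset.mem_image.1 ht'
    exact hne (link_inj R.embed (mem_roots.1 hk').1 (mem_roots.1 hk).1 (hmult k' hk')
      (hmult k hk) hj).1.symm

end FairRun
end Compare
end Streaming

theorem mainTheorem3 {α : Type*} [DecidableEq α] (u : Streaming.UnionReading)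
    (δ D L : ℕ) (hδ : 0 < δ) (hDL : D ≤ L)
    (S : ℕ → Streaming.Item (Streaming.ETup α))
    (hE : Streaming.IsEmbedStream δ S) (hW : Streaming.WatermarksSound S)
    (hC1 : Streaming.C1 S D)
    (act : ℕ → Streaming.Act) (run : ℕ → Streaming.State α)
    (hrun : Streaming.IsExecution u δ L S act run)
    (hfair : Streaming.Fair u δ L act run)
    (hC2 : Streaming.C2 u δ L act run) (hC3 : Streaming.C3 run) :
    (∀ n, (Streaming.tuplesOf (run n).sA2).Nodup) ∧
    (∀ x : Streaming.Tup α,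
      (∃ n, Streaming.Item.tup x ∈ (run n).sO) ↔
        ∃ n t, S n = .tup t ∧ x ∈ Streaming.unfold t) ∧
    (u = .bag ∨ Streaming.NoRepeats S →
      ∀ x : Streaming.Tup α, ∃ N, ∀ n m, N ≤ n → N ≤ m →
        (run n).sO.count (.tup x) = (Streaming.unfoldPrefix S m).count x) := by
  have R := Streaming.fairRun_of_isExecution hδ hDL hE hW hC1 hrun hfair hC2 hC3
  refine ⟨fun n => (R.loop n).nodup, fun x => ⟨?_, ?_⟩, fun h x => ?_⟩
  · rintro ⟨n, hn⟩
    exact R.exists_mem_unfold hn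
  · rintro ⟨n, t, hS, hx⟩
    exact R.exists_mem_sO hC1 hS hx
  · obtain ⟨p, w, hw, hxw⟩ := hC1.exists_wmsIn_ge (x.τ + δ)
    obtain ⟨N, hN⟩ := Filter.eventually_atTop.1 (R.eventually_count_sO hC1 x hw hxw)
    refine ⟨max N p, fun n m hn hm => ?_⟩
    rw [hN n ((le_max_left _ _).trans hn), Streaming.count_unfoldPrefix hW hw (by omega)
      ((le_max_right _ _).trans hm)]
    refine Finset.sum_congr rfl fun k hk => Streaming.count_unionPow u (h.imp id fun hnr => ?_) _ _
    obtain ⟨i, -, hi⟩ := Streaming.mem_recv.1 (Streaming.mem_roots.1 hk).1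
    exact hnr.mult_eq_one hi
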